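/- Let $n\ge 2$ and let $\Omega\subseteq\mathbb{R}^n$ be a domain (a non-empty connected open set). Let $1<p<n$, $1\le\beta<n/p$, $0\le\gamma\le n$ and $1/q=1/p-\beta/n$. For $s\geq 1$ let $W^{1,s}(\Omega)$ be the space of real-valued $f\in L^s(\Omega)$ whose weak gradient $\nabla f$ exists and lies in $L^s(\Omega)$, with $\|f\|_{W^{1,s}(\Omega)}=\|f\|_{L^s(\Omega)}+\|\nabla f\|_{L^s(\Omega)}$. Put $\varphi(t)=(1+t)^\gamma$ and, for $f\in W^{1,p}(\Omega)$ and $x\in\Omega$, $$M_{\varphi,\beta,\Omega}f(x)=\sup_{0<r<\mathrm{dist}(x,\Omega^c)}\frac{r^\beta(1+r^n)^{\gamma\beta/n}}{\varphi(|B(x,r)|)\,|B(x,r)|}\int_{B(x,r)}|f(y)|\,dy,$$ where $\Omega^c=\mathbb{R}^n\setminus\Omega$ (and $\mathrm{dist}(x,\emptyset)=\infty$). Suppose that $\Omega$ admits a $p$-Sobolev embedding, that is, there is a constant $C_0>0$ with $\|f\|_{L^{p^*}(\Omega)}\le C_0\|f\|_{W^{1,p}(\Omega)}$ for all $f\in W^{1,p}(\Omega)$,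 where $p^*=np/(n-p)$. Then there is a constant $C>0$, independent of $f$, such that for every $f\in W^{1,p}(\Omega)$ the function $M_{\varphi,\beta,\Omega}f$ is finite almost everywhere in $\Omega$, belongs to $W^{1,q}(\Omega)$, and satisfies $$\|M_{\varphi,\beta,\Omega}f\|_{W^{1,q}(\Omega)}\le C\|f\|_{W^{1,p}(\Omega)}.$$ -/

import Mathlib

open MeasureTheory
open scoped ENNReal ContDiff

namespace LocalMaximal

/-- `g` is a weak gradient of `f` on the open set `Ω ⊆ ℝⁿ`: both are locally integrable on `Ω` and
`∫_Ω f ∂ᵢφ = - ∫_Ω gᵢ φ` for each `i` and each test function `φ ∈ C_c^∞(Ω)`. -/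
structure HasWeakGradient {n : ℕ} (Ω : Set (EuclideanSpace ℝ (Fin n)))
    (f : EuclideanSpace ℝ (Fin n) → ℝ)
    (g : EuclideanSpace ℝ (Fin n) → EuclideanSpace ℝ (Fin n)) : Prop where
  locallyIntegrableOn : LocallyIntegrableOn f Ω
  locallyIntegrableOn_grad : LocallyIntegrableOn g Ω
  integral_eq : ∀ φ : EuclideanSpace ℝ (Fin n) → ℝ,
    ContDiff ℝ ∞ φ → HasCompactSupport φ → tsupport φ ⊆ Ω →
    ∀ i : Fin n, ∫ x in Ω, f x * fderiv ℝ φ x (EuclideanSpace.single i 1)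
      = - ∫ x in Ω, g x i * φ x

/-- Weak gradients are unique up to null sets, so the choice made in `weakGradient` is
immaterial. -/
theorem HasWeakGradient.ae_eq {n : ℕ} {Ω : Set (EuclideanSpace ℝ (Fin n))} (hΩ : IsOpen Ω)
    {f : EuclideanSpace ℝ (Fin n) → ℝ}
    {g h : EuclideanSpace ℝ (Fin n) → EuclideanSpace ℝ (Fin n)}
    (hg : HasWeakGradient Ω f g) (hh : HasWeakGradient Ω f h) :
    g =ᵐ[volume.restrict Ω] h := by
  have comp : ∀ (k : EuclideanSpace ℝ (Fin n) → EuclideanSpace ℝ (Fin n)) (i : Fin n),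
      LocallyIntegrableOn k Ω → LocallyIntegrableOn (fun x => k x i) Ω := by
    intro k i hk x hx
    obtain ⟨t, ht, hkt⟩ := hk x hx
    exact ⟨t, ht, (EuclideanSpace.proj (𝕜 := ℝ) i).integrable_comp hkt⟩
  have key : ∀ i : Fin n, ∀ᵐ x ∂volume, x ∈ Ω → g x i - h x i = 0 := by
    intro i
    have hgi := comp g i hg.locallyIntegrableOn_grad
    have hhi := comp h i hh.locallyIntegrableOn_grad
    refine hΩ.ae_eq_zero_of_integral_contDiff_smul_eq_zero (hgi.sub hhi) ?_
    intro φ hφ hc hs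
    have int : ∀ u : EuclideanSpace ℝ (Fin n) → ℝ, LocallyIntegrableOn u Ω →
        IntegrableOn (fun x => u x * φ x) Ω := by
      intro u hu
      have h1 : IntegrableOn u (tsupport φ) := hu.integrableOn_compact_subset hs hc
      have h2 : IntegrableOn (fun x => u x * φ x) (tsupport φ) :=
        h1.mul_continuousOn hφ.continuous.continuousOn hc
      refine IntegrableOn.of_forall_sdiff_eq_zero h2 hΩ.measurableSet ?_
      intro x hx
      simp [image_eq_zero_of_notMem_tsupport hx.2]
    have e : ∫ x in Ω, g x i * φ x = ∫ x in Ω, h x i * φ x := by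
      have a := hg.integral_eq φ hφ hc hs i
      have b := hh.integral_eq φ hφ hc hs i
      linarith
    have z : ∫ x in Ω, φ x • (g x i - h x i) = 0 := by
      have : (fun x => φ x • (g x i - h x i)) = fun x => g x i * φ x - h x i * φ x := by
        funext x; simp only [smul_eq_mul]; ring
      rw [this, integral_sub (int _ hgi) (int _ hhi), e, sub_self]
    rw [← z]
    refine (setIntegral_eq_integral_of_forall_compl_eq_zero ?_).symm
    intro x hx
    have : φ x = 0 := image_eq_zero_of_notMem_tsupport fun h' => hx (hs h')
    simp [this]
  rw [Filter.EventuallyEq, ae_restrict_iff' hΩ.measurableSet]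
  filter_upwards [ae_all_iff.2 key] with x hx hxΩ
  ext i
  exact sub_eq_zero.1 (hx i hxΩ)

open Classical in
/-- The weak gradient `∇f` on `Ω` (junk value `0` when there is none). -/
noncomputable def weakGradient {n : ℕ} (Ω : Set (EuclideanSpace ℝ (Fin n)))
    (f : EuclideanSpace ℝ (Fin n) → ℝ) : EuclideanSpace ℝ (Fin n) → EuclideanSpace ℝ (Fin n) :=
  if h : ∃ g, HasWeakGradient Ω f g then h.choose else 0

/-- `f ∈ W^{1,p}(Ω)`: `f ∈ L^p(Ω)`, and `f` has a weak gradient on `Ω` that lies in `L^p(Ω)`.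
Only the values of `f` on `Ω` matter. -/
def MemSobolev {n : ℕ} (Ω : Set (EuclideanSpace ℝ (Fin n))) (p : ℝ)
    (f : EuclideanSpace ℝ (Fin n) → ℝ) : Prop :=
  MemLp f (ENNReal.ofReal p) (volume.restrict Ω) ∧
    ∃ g, HasWeakGradient Ω f g ∧ MemLp g (ENNReal.ofReal p) (volume.restrict Ω)

/-- `‖f‖_{W^{1,p}(Ω)} = ‖f‖_{L^p(Ω)} + ‖∇f‖_{L^p(Ω)}`, meaningful for `f ∈ W^{1,p}(Ω)`. -/
noncomputable def sobolevNorm {n : ℕ} (Ω : Set (EuclideanSpace ℝ (Fin n))) (p : ℝ)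
    (f : EuclideanSpace ℝ (Fin n) → ℝ) : ℝ≥0∞ :=
  eLpNorm f (ENNReal.ofReal p) (volume.restrict Ω) +
    eLpNorm (weakGradient Ω f) (ENNReal.ofReal p) (volume.restrict Ω)

/-- `Ω` admits a `p`-Sobolev embedding (`1 ≤ p < n`): `W^{1,p}(Ω)` embeds boundedly into
`L^{p*}(Ω)` with `p* = np/(n-p)`. -/
def AdmitsSobolevEmbedding {n : ℕ} (Ω : Set (EuclideanSpace ℝ (Fin n))) (p : ℝ) : Prop :=
  ∃ C : ℝ, 0 < C ∧ ∀ f : EuclideanSpace ℝ (Fin n) → ℝ, MemSobolev Ω p f →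
    eLpNorm f (ENNReal.ofReal (n * p / (n - p))) (volume.restrict Ω)
      ≤ ENNReal.ofReal C * sobolevNorm Ω p f

/-- `φ(t) = (1 + t)^γ`. -/
noncomputable def phi (γ t : ℝ) : ℝ := (1 + t) ^ γ

/-- The local fractional new maximal function
`M_{φ,β,Ω} f(x) = sup_{0 < r < dist(x, Ωᶜ)} r^β (1+r^n)^{γβ/n} / (φ(|B(x,r)|) |B(x,r)|) ∫_{B(x,r)} |f|`,
with values in `[0, ∞]`. The distance is the extended one, so that it is `∞` for `Ω = ℝⁿ`. -/
noncomputable def maximalFn {n : ℕ} (γ β : ℝ) (Ω : Set (EuclideanSpace ℝ (Fin n)))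
    (f : EuclideanSpace ℝ (Fin n) → ℝ) (x : EuclideanSpace ℝ (Fin n)) : ℝ≥0∞ :=
  ⨆ (r : ℝ) (_ : 0 < r) (_ : ENNReal.ofReal r < Metric.infEDist x Ωᶜ),
    ENNReal.ofReal (r ^ β * (1 + r ^ n) ^ (γ * β / n) /
        (phi γ (volume.real (Metric.ball x r)) * volume.real (Metric.ball x r))) *
      ∫⁻ y in Metric.ball x r, ENNReal.ofReal |f y|

end LocalMaximal

namespace LocalMaximal

open Metric Module Filter Topology Set

/-! ### Fractional maximal functions of measures and the Hardy–Littlewood maximal inequality. -/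

section Maximal

variable {E : Type*} [NormedAddCommGroup E] [MeasurableSpace E]

/-! Write `F` for the maximal function of `f`, `M_α` for `fractionalMaximal α`, and extend `f` and
its weak gradient `g` by zero outside Ω. As β ≤ n, the exponent γβ/n is at most γ, so the kernel is
r⁻ⁿ K(r) with |K(r)| ≤ C r^β and |K'(r)| ≤ C r^(β-1) (`exists_radialWeight_bound`). Hence F ≤ C
M_β|f|, and the fractional maximal inequality L^p → L^q (`eLpNorm_fractionalMaximal_le`, from the
Hardy–Littlewood inequality and Hedberg's trick) controls `F` itself.

For the gradient, take |x-y| < dist(x, Ωᶜ) and a ball B(x,r) admissible for `x`. Choose D < dist(x,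
Ωᶜ) above both r and |x-y|, and move the ball along the segment to `y` while shrinking its radius
linearly to r - r|x-y|/D. All these balls stay in B(x,D), and the last one is admissible for `y`.
Differentiating the weighted average along this path bounds its variation by |x-y| times the
integral over the segment of G = C(M_(β-1)|f| + 2 M_β|g|). Mollification reduces this to C¹
functions (`HasWeakGradient.setLIntegral_ball_le`), and the supremum over r gives F(x) ≤ F(y) +
|x-y| ∫₀¹ G(x+t(y-x)) dt (`HasWeakGradient.maximalFn_le_add_lintegral_segment`).

The function `G` is in L^q: the term with `g` by the same maximal inequality, the term with `f`
because the Sobolev embedding puts `f` in L^(p*) and 1/q = 1/p* - (β-1)/n. Finally, the segment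
inequality bounds difference quotients tested against φ, so each distributional derivative of `F` is
dominated by the L¹ seminorm with weight 2G. By Hahn–Banach and the duality of L¹ and L^∞ it is a
function bounded by 2G (`exists_hasWeakGradient_of_segment_bound`). -/

lemma lowerSemicontinuous_measure_ball (ν : Measure E) (r : ℝ) :
    LowerSemicontinuous (fun x => ν (ball x r)) := by
  intro x a ha
  -- A slightly smaller concentric ball already has measure above `a`, and it lies in the ball of
  -- radius `r` about every nearby point.
  have hU : ball x r = ⋃ k : ℕ, ball x (r - 1 / (k + 1)) := by
    ext y
    simp only [mem_ball, mem_iUnion]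
    constructor
    · intro h
      obtain ⟨k, hk⟩ := exists_nat_one_div_lt (sub_pos.2 h)
      exact ⟨k, by linarith⟩
    · rintro ⟨k, hk⟩
      have : (0 : ℝ) < 1 / (k + 1) := Nat.one_div_pos_of_nat
      linarith
  have hmono : Monotone fun k : ℕ => ball x (r - 1 / ((k : ℝ) + 1)) := by
    intro k l hkl
    apply ball_subset_ball
    have : (1 : ℝ) / (l + 1) ≤ 1 / (k + 1) := Nat.one_div_le_one_div hkl
    linarith
  simp only at ha
  rw [hU, hmono.measure_iUnion, gt_iff_lt, lt_iSup_iff] at ha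
  obtain ⟨k, hk⟩ := ha
  have hpos : (0 : ℝ) < 1 / (k + 1) := Nat.one_div_pos_of_nat
  filter_upwards [ball_mem_nhds x hpos] with y hy
  refine hk.trans_le (measure_mono (ball_subset_ball' ?_))
  rw [mem_ball, dist_comm] at hy
  linarith

lemma lowerSemicontinuous_const_mul_measure_ball (ν : Measure E) (r c : ℝ) :
    LowerSemicontinuous (fun x => ENNReal.ofReal c * ν (ball x r)) :=
  (ENNReal.continuous_const_mul ENNReal.ofReal_ne_top).comp_lowerSemicontinuous
    (lowerSemicontinuous_measure_ball ν r) fun _ _ h => mul_le_mul_right h _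

variable [NormedSpace ℝ E]

/-- The fractional maximal function
`M_α ν (x) = sup_{r > 0} r ^ (α - d) ν(B(x, r))` of a measure on a `d`-dimensional space. -/
noncomputable def fractionalMaximal (α : ℝ) (ν : Measure E) (x : E) : ℝ≥0∞ :=
  ⨆ (r : ℝ) (_ : 0 < r), ENNReal.ofReal (r ^ (α - finrank ℝ E)) * ν (ball x r)

variable [BorelSpace E]

/-- The supremum runs over uncountably many radii, so measurability comes from lower semicontinuity,
which survives arbitrary suprema. -/
lemma measurable_fractionalMaximal (α : ℝ) (ν : Measure E) :
    Measurable (fractionalMaximal α ν) :=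
  (lowerSemicontinuous_biSup fun r _ =>
    lowerSemicontinuous_const_mul_measure_ball ν r _).measurable

variable [FiniteDimensional ℝ E] [Nontrivial E] (μ : Measure E) [μ.IsAddHaarMeasure]

/-- The weak type `(1, 1)` inequality. -/
lemma mul_measure_lt_fractionalMaximal_le (ν : Measure E) {t : ℝ} (ht : 0 < t) :
    ENNReal.ofReal t * μ {x | ENNReal.ofReal t < fractionalMaximal 0 ν x} ≤
      ENNReal.ofReal (4 ^ finrank ℝ E) * μ (ball 0 1) * ν univ := by
  set d := finrank ℝ E with hd
  have hd0 : d ≠ 0 := (finrank_pos (R := ℝ) (M := E)).ne'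
  have hκ : μ (ball (0 : E) 1) ≠ 0 := (measure_ball_pos μ 0 one_pos).ne'
  by_cases hν : ν univ = ⊤
  · rw [hν, ENNReal.mul_top]
    · exact le_top
    · exact mul_ne_zero (by simp) hκ
  set S := {x | ENNReal.ofReal t < fractionalMaximal 0 ν x} with hS
  have hex : ∀ x ∈ S, ∃ r : ℝ, 0 < r ∧
      ENNReal.ofReal t * ENNReal.ofReal (r ^ d) ≤ ν (ball x r) := by
    intro x hx
    simp only [hS, mem_ofPred_eq, fractionalMaximal, lt_iSup_iff] at hx
    obtain ⟨r, hr, h⟩ := hx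
    refine ⟨r, hr, ?_⟩
    have hrd : (0 : ℝ) < r ^ d := pow_pos hr d
    rw [zero_sub, Real.rpow_neg hr.le, Real.rpow_natCast, ENNReal.ofReal_inv_of_pos hrd] at h
    calc _ ≤ (ENNReal.ofReal (r ^ d))⁻¹ * ν (ball x r) * ENNReal.ofReal (r ^ d) := by gcongr
      _ = ν (ball x r) := by
        rw [mul_right_comm, ENNReal.inv_mul_cancel (by simpa using hrd) ENNReal.ofReal_ne_top,
          one_mul]
  choose! r hr0 hr using hex
  -- Vitali's covering lemma needs bounded radii. The bound follows from t r^d ≤ ν(E), with r ≤ r^d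
  -- for r > 1 replacing a d-th root.
  have hbdd : ∀ x ∈ S, r x ≤ max 1 ((ν univ).toReal / t) := by
    intro x hx
    by_cases h1 : r x ≤ 1
    · exact h1.trans (le_max_left _ _)
    · refine le_trans ?_ (le_max_right _ _)
      rw [le_div_iff₀ ht]
      have h2 := (hr x hx).trans (measure_mono (subset_univ _))
      rw [← ENNReal.ofReal_mul ht.le, ENNReal.ofReal_le_iff_le_toReal hν] at h2
      have h3 : r x ≤ r x ^ d := le_self_pow₀ (not_le.1 h1).le hd0
      nlinarith
  obtain ⟨u, huS, hdis, hcov⟩ := Vitali.exists_disjoint_subfamily_covering_enlargement_ball S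
    (fun x => x) r _ hbdd 4 (by norm_num)
  have hcount : u.Countable := hdis.countable_of_isOpen (fun _ _ => isOpen_ball)
    fun x hx => ⟨x, mem_ball_self (hr0 x (huS hx))⟩
  have hSsub : S ⊆ ⋃ b ∈ u, ball b (4 * r b) := by
    intro x hx
    obtain ⟨b, hb, hsub⟩ := hcov x hx
    exact mem_biUnion hb (hsub (mem_ball_self (hr0 x hx)))
  calc ENNReal.ofReal t * μ S
      ≤ ENNReal.ofReal t * ∑' b : u, μ (ball (b : E) (4 * r b)) := by
        gcongr
        exact (measure_mono hSsub).trans (measure_biUnion_le μ hcount _)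
    _ = ∑' b : u, ENNReal.ofReal t * μ (ball (b : E) (4 * r b)) := ENNReal.tsum_mul_left.symm
    _ ≤ ∑' b : u, ENNReal.ofReal (4 ^ d) * μ (ball 0 1) * ν (ball (b : E) (r b)) := by
        refine ENNReal.tsum_le_tsum fun b => ?_
        have hb := huS b.2
        rw [Measure.addHaar_ball_of_pos μ _ (by linarith [hr0 _ hb]), mul_pow,
          ENNReal.ofReal_mul (by positivity)]
        calc _ = ENNReal.ofReal (4 ^ d) * μ (ball 0 1) *
              (ENNReal.ofReal t * ENNReal.ofReal (r b ^ d)) := by ring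
          _ ≤ _ := by gcongr; exact hr _ hb
    _ = ENNReal.ofReal (4 ^ d) * μ (ball 0 1) * ν (⋃ b ∈ u, ball (b : E) (r b)) := by
        rw [ENNReal.tsum_mul_left, measure_biUnion hcount hdis fun _ _ => measurableSet_ball]
    _ ≤ _ := by gcongr; exact subset_univ _

/-- Cut `h` at height t/(2κ), with κ the volume of the unit ball. Since r⁻ᵈ μ(B(x,r)) = κ, the low
part adds at most t/2 to the maximal function, and the weak type inequality at level t/2 handles the
high part. Keeping only the high part on the right is what makes integration in t possible. -/
lemma mul_measure_lt_fractionalMaximal_withDensity_le {h : E → ℝ} (hm : Measurable h) {t : ℝ}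
    (ht : 0 < t) :
    ENNReal.ofReal t *
        μ {x | ENNReal.ofReal t < fractionalMaximal 0 (μ.withDensity fun x => .ofReal (h x)) x} ≤
      2 * (ENNReal.ofReal (4 ^ finrank ℝ E) * μ (ball 0 1)) *
        μ.withDensity (fun x => .ofReal (h x)) {x | t < 2 * μ.real (ball 0 1) * h x} := by
  set ν := μ.withDensity fun x => ENNReal.ofReal (h x) with hν
  set κ := μ.real (ball (0 : E) 1) with hκ
  have hκ0 : 0 < κ := by
    rw [hκ, measureReal_def, ENNReal.toReal_pos_iff]
    exact ⟨measure_ball_pos μ 0 one_pos, measure_ball_lt_top⟩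
  have hκe : μ (ball (0 : E) 1) = ENNReal.ofReal κ := by
    rw [hκ, ofReal_measureReal measure_ball_lt_top.ne]
  set A := {x | t < 2 * κ * h x} with hA
  have hAm : MeasurableSet A := measurableSet_lt measurable_const (hm.const_mul _)
  have hball : ∀ x r, ν (ball x r) ≤
      ν.restrict A (ball x r) + ENNReal.ofReal (t / (2 * κ)) * μ (ball x r) := by
    intro x r
    rw [Measure.restrict_apply measurableSet_ball, ← measure_inter_add_sdiff (ball x r) hAm]
    gcongr
    rw [hν, withDensity_apply _ (measurableSet_ball.diff hAm)]
    calc ∫⁻ y in ball x r \ A, ENNReal.ofReal (h y) ∂μ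
        ≤ ∫⁻ y in ball x r \ A, ENNReal.ofReal (t / (2 * κ)) ∂μ := by
          refine setLIntegral_mono measurable_const fun y hy => ENNReal.ofReal_le_ofReal ?_
          have := hy.2
          simp only [hA, mem_ofPred_eq, not_lt] at this
          rw [le_div_iff₀ (by positivity)]
          linarith
      _ = ENNReal.ofReal (t / (2 * κ)) * μ (ball x r \ A) := setLIntegral_const _ _
      _ ≤ _ := by gcongr; exact sdiff_subset
  have hM : ∀ x, fractionalMaximal 0 ν x ≤
      fractionalMaximal 0 (ν.restrict A) x + ENNReal.ofReal (t / 2) := by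
    intro x
    refine iSup₂_le fun r hr => ?_
    have hrd : (0 : ℝ) < r ^ finrank ℝ E := pow_pos hr _
    calc _ ≤ ENNReal.ofReal (r ^ ((0 : ℝ) - finrank ℝ E)) * (ν.restrict A (ball x r) +
          ENNReal.ofReal (t / (2 * κ)) * μ (ball x r)) := by gcongr; exact hball x r
      _ = ENNReal.ofReal (r ^ ((0 : ℝ) - finrank ℝ E)) * ν.restrict A (ball x r) +
          ENNReal.ofReal (t / 2) := by
        rw [mul_add, Measure.addHaar_ball_of_pos μ _ hr, hκe, ← ENNReal.ofReal_mul (by positivity),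
          ← ENNReal.ofReal_mul (by positivity), ← ENNReal.ofReal_mul (by positivity)]
        congr 2
        rw [zero_sub, Real.rpow_neg hr.le, Real.rpow_natCast]
        field_simp
      _ ≤ _ := by
        gcongr
        exact le_iSup₂ (f := fun (r : ℝ) (_ : 0 < r) =>
          ENNReal.ofReal (r ^ ((0 : ℝ) - finrank ℝ E)) * ν.restrict A (ball x r)) r hr
  have hsub : {x | ENNReal.ofReal t < fractionalMaximal 0 ν x} ⊆
      {x | ENNReal.ofReal (t / 2) < fractionalMaximal 0 (ν.restrict A) x} := by
    intro x hx
    by_contra hcon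
    simp only [mem_ofPred_eq, not_lt] at hx hcon
    have h1 := (hM x).trans (add_le_add_left hcon _)
    rw [← ENNReal.ofReal_add (by positivity) (by positivity), add_halves] at h1
    exact absurd hx h1.not_gt
  calc _ ≤ ENNReal.ofReal t *
        μ {x | ENNReal.ofReal (t / 2) < fractionalMaximal 0 (ν.restrict A) x} := by gcongr
    _ = 2 * (ENNReal.ofReal (t / 2) *
        μ {x | ENNReal.ofReal (t / 2) < fractionalMaximal 0 (ν.restrict A) x}) := by
      rw [← mul_assoc, ← ENNReal.ofReal_ofNat 2, ← ENNReal.ofReal_mul (by norm_num)]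
      congr 2
      ring
    _ ≤ 2 * (ENNReal.ofReal (4 ^ finrank ℝ E) * μ (ball 0 1) * ν.restrict A univ) := by
      exact mul_le_mul_right (mul_measure_lt_fractionalMaximal_le μ _ (half_pos ht)) _
    _ = _ := by rw [Measure.restrict_apply_univ]; ring

/-- The Hardy–Littlewood maximal inequality for real densities. -/
lemma lintegral_fractionalMaximal_rpow_le_of_real {s : ℝ} (hs : 1 < s) :
    ∃ C : ℝ≥0∞, C ≠ ⊤ ∧ ∀ h : E → ℝ, Measurable h → (∀ x, 0 ≤ h x) →
      ∫⁻ x, ENNReal.ofReal (h x) ^ s ∂μ ≠ ⊤ →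
      ∫⁻ x, fractionalMaximal 0 (μ.withDensity fun x => .ofReal (h x)) x ^ s ∂μ ≤
        C * ∫⁻ x, ENNReal.ofReal (h x) ^ s ∂μ := by
  set K : ℝ≥0∞ := 2 * (ENNReal.ofReal (4 ^ finrank ℝ E) * μ (ball 0 1)) with hK
  have hKtop : K ≠ ⊤ := by
    have : μ (ball (0 : E) 1) ≠ ⊤ := measure_ball_lt_top.ne
    finiteness
  set κ := μ.real (ball (0 : E) 1) with hκ
  have hκ0 : 0 < κ := by
    rw [hκ, measureReal_def, ENNReal.toReal_pos_iff]
    exact ⟨measure_ball_pos μ 0 one_pos, measure_ball_lt_top⟩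
  have hs1 : (0 : ℝ) < s - 1 := by linarith
  refine ⟨ENNReal.ofReal s * (K * ((ENNReal.ofReal (s - 1))⁻¹ * ENNReal.ofReal ((2 * κ) ^ (s - 1)))),
    ?_, ?_⟩
  · have : ENNReal.ofReal (s - 1) ≠ 0 := by simpa using hs
    finiteness
  intro h hm h0 hI
  set I := ∫⁻ x, ENNReal.ofReal (h x) ^ s ∂μ with hIdef
  set ν := μ.withDensity fun x => ENNReal.ofReal (h x) with hν
  set M := fractionalMaximal 0 ν with hM
  have hMm : Measurable M := measurable_fractionalMaximal 0 ν
  have hmul : ∀ x, ENNReal.ofReal (h x ^ (s - 1)) * ENNReal.ofReal (h x) =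
      ENNReal.ofReal (h x) ^ s := by
    intro x
    rw [← ENNReal.ofReal_mul (by have := h0 x; positivity),
      ENNReal.ofReal_rpow_of_nonneg (h0 x) (by linarith)]
    congr 1
    rcases (h0 x).eq_or_lt with hx | hx
    · rw [← hx, mul_zero, Real.zero_rpow (by linarith)]
    · rw [← Real.rpow_add_one hx.ne']; congr 1; ring
  have hfin : ∀ᵐ x ∂μ, M x < ⊤ := by
    -- For t ≥ 2κ the set t < 2κh lies in h ≥ 1, where h ≤ h^s. The bound is thus uniform in `t`,
    -- and letting `t` grow forces M < ∞ almost everywhere.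
    have key : ∀ t : ℝ, 2 * κ ≤ t → ENNReal.ofReal t * μ {x | M x = ⊤} ≤ K * I := by
      intro t ht
      have ht0 : 0 < t := lt_of_lt_of_le (by positivity) ht
      calc _ ≤ ENNReal.ofReal t * μ {x | ENNReal.ofReal t < M x} := by
            gcongr with x
            intro hx
            rw [hx]; exact ENNReal.ofReal_lt_top
        _ ≤ _ := mul_measure_lt_fractionalMaximal_withDensity_le μ hm ht0
        _ ≤ K * I := by
          gcongr
          rw [withDensity_apply _ (measurableSet_lt measurable_const (hm.const_mul _))]
          refine (setLIntegral_mono (g := fun x => ENNReal.ofReal (h x) ^ s) (by fun_prop)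
            fun x hx => ?_).trans (setLIntegral_le_lintegral _ _)
          have hx1 : 1 ≤ h x := by
            simp only [mem_ofPred_eq] at hx
            have := ht.trans_lt hx
            exact ((lt_mul_iff_one_lt_right (by positivity)).1 this).le
          calc ENNReal.ofReal (h x) = ENNReal.ofReal (h x) ^ (1 : ℝ) := (ENNReal.rpow_one _).symm
            _ ≤ _ := ENNReal.rpow_le_rpow_of_exponent_le (by simpa using hx1) hs.le
    have hz : μ {x | M x = ⊤} = 0 := by
      by_contra hne
      have htop : K * I / μ {x | M x = ⊤} ≠ ⊤ := ENNReal.div_ne_top (by finiteness) hne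
      have hne' : μ {x | M x = ⊤} ≠ ⊤ := by
        intro htop'
        have := key (2 * κ) le_rfl
        rw [htop', ENNReal.mul_top (by simpa using hκ0), top_le_iff] at this
        exact ENNReal.mul_ne_top hKtop hI this
      set T := max (2 * κ) ((K * I / μ {x | M x = ⊤}).toReal + 1) with hT
      have h1 := key T (le_max_left _ _)
      rw [← ENNReal.le_div_iff_mul_le (Or.inl hne) (Or.inl hne'),
        ENNReal.ofReal_le_iff_le_toReal htop] at h1
      have := le_max_right (2 * κ) ((K * I / μ {x | M x = ⊤}).toReal + 1)
      linarith
    rw [ae_iff]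
    simpa using hz
  have e1 : ∫⁻ x, M x ^ s ∂μ = ∫⁻ x, ENNReal.ofReal ((M x).toReal ^ s) ∂μ := by
    refine lintegral_congr_ae ?_
    filter_upwards [hfin] with x hx
    rw [← ENNReal.ofReal_rpow_of_nonneg ENNReal.toReal_nonneg (by linarith),
      ENNReal.ofReal_toReal hx.ne]
  -- Layer cake is used twice: with exponent `s` for `M` under `μ`, and with exponent s-1 for 2κh
  -- under ν = hμ. Writing t^(s-1) = t · t^(s-2), the weak type bound passes from the first to the
  -- second, and ∫ h^(s-1) dν = ∫ h^s dμ.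
  have e2 := lintegral_rpow_eq_lintegral_meas_lt_mul (f := fun x => (M x).toReal) μ
    (Eventually.of_forall fun _ => ENNReal.toReal_nonneg) hMm.ennreal_toReal.aemeasurable
    (p := s) (by linarith)
  have e3 := lintegral_rpow_eq_lintegral_meas_lt_mul (f := fun x => 2 * κ * h x) ν
    (Eventually.of_forall fun x => by have := h0 x; positivity) (hm.const_mul _).aemeasurable hs1
  have e4 : ∫⁻ x, ENNReal.ofReal ((2 * κ * h x) ^ (s - 1)) ∂ν =
      ENNReal.ofReal ((2 * κ) ^ (s - 1)) * I := by
    rw [hν, lintegral_withDensity_eq_lintegral_mul _ hm.ennreal_ofReal (by fun_prop), hIdef,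
      ← lintegral_const_mul _ (by fun_prop)]
    refine lintegral_congr fun x => ?_
    rw [Pi.mul_apply, Real.mul_rpow (by positivity) (h0 x), ENNReal.ofReal_mul (by positivity),
      ← hmul]
    ring
  have e5 : ∫⁻ t in Ioi 0, μ {x | t < (M x).toReal} * ENNReal.ofReal (t ^ (s - 1)) ≤
      K * ∫⁻ t in Ioi 0, ν {x | t < 2 * κ * h x} * ENNReal.ofReal (t ^ (s - 1 - 1)) := by
    rw [← lintegral_const_mul' _ _ hKtop]
    refine setLIntegral_mono' measurableSet_Ioi fun t ht => ?_
    rw [mem_Ioi] at ht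
    calc _ ≤ μ {x | ENNReal.ofReal t < M x} * ENNReal.ofReal (t ^ (s - 1)) := by
          gcongr with x
          intro hx
          refine (ENNReal.ofReal_lt_iff_lt_toReal ht.le fun htop => ?_).2 hx
          rw [htop, ENNReal.toReal_top] at hx
          exact lt_asymm ht hx
      _ = ENNReal.ofReal t * μ {x | ENNReal.ofReal t < M x} * ENNReal.ofReal (t ^ (s - 1 - 1)) := by
          rw [mul_comm (ENNReal.ofReal t), mul_assoc, ← ENNReal.ofReal_mul ht.le]
          congr 2
          rw [Real.rpow_sub_one ht.ne' (s - 1)]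
          field_simp
      _ ≤ K * ν {x | t < 2 * κ * h x} * ENNReal.ofReal (t ^ (s - 1 - 1)) := by
          exact mul_le_mul_left (mul_measure_lt_fractionalMaximal_withDensity_le μ hm ht) _
      _ = _ := by ring
  have e6 : ∫⁻ t in Ioi 0, ν {x | t < 2 * κ * h x} * ENNReal.ofReal (t ^ (s - 1 - 1)) =
      (ENNReal.ofReal (s - 1))⁻¹ * ENNReal.ofReal ((2 * κ) ^ (s - 1)) * I := by
    rw [mul_assoc, ← e4, e3, ← mul_assoc, ENNReal.inv_mul_cancel (by simpa using hs)
      ENNReal.ofReal_ne_top, one_mul]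
  rw [e1, e2, mul_assoc, mul_assoc, ← e6]
  gcongr

end Maximal

/-! ### Hedberg's inequality and the fractional maximal inequality from L^s to L^q. -/

section FractionalIntegration

variable {E : Type*} [NormedAddCommGroup E] [MeasurableSpace E] [NormedSpace ℝ E] [BorelSpace E]
  [FiniteDimensional ℝ E] [Nontrivial E] (μ : Measure E) [μ.IsAddHaarMeasure]

/-- The Hardy–Littlewood maximal inequality. -/
lemma lintegral_fractionalMaximal_rpow_le {s : ℝ} (hs : 1 < s) :
    ∃ C : ℝ≥0∞, C ≠ ⊤ ∧ ∀ h : E → ℝ≥0∞, AEMeasurable h μ →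
      ∫⁻ x, h x ^ s ∂μ ≠ ⊤ →
      ∫⁻ x, fractionalMaximal 0 (μ.withDensity h) x ^ s ∂μ ≤ C * ∫⁻ x, h x ^ s ∂μ := by
  obtain ⟨C, hC, H⟩ := lintegral_fractionalMaximal_rpow_le_of_real μ hs
  refine ⟨C, hC, fun h hm hI => ?_⟩
  have hfin : ∀ᵐ x ∂μ, h x < ⊤ := by
    filter_upwards [ae_lt_top' (hm.pow_const s) hI] with x hx
    rwa [ENNReal.rpow_lt_top_iff_of_pos (by linarith)] at hx
  have hae : (fun x => ENNReal.ofReal (hm.mk h x).toReal) =ᵐ[μ] h := by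
    filter_upwards [hm.ae_eq_mk, hfin] with x hx hx'
    rw [← hx, ENNReal.ofReal_toReal hx'.ne]
  have hae' : ∫⁻ x, ENNReal.ofReal (hm.mk h x).toReal ^ s ∂μ = ∫⁻ x, h x ^ s ∂μ :=
    lintegral_congr_ae (hae.fun_comp (· ^ s))
  have := H (fun x => (hm.mk h x).toReal) hm.measurable_mk.ennreal_toReal
    (fun _ => ENNReal.toReal_nonneg) (by rwa [hae'])
  rwa [withDensity_congr_ae hae, hae'] at this

/-- Hedberg's pointwise inequality. -/
lemma fractionalMaximal_le_mul_rpow {s α : ℝ} (hs : 1 < s) (hα : 0 ≤ α)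
    (hαs : α < finrank ℝ E / s) {h : E → ℝ≥0∞} (hm : AEMeasurable h μ) (x : E) :
    fractionalMaximal α (μ.withDensity h) x ≤
      (eLpNorm h (.ofReal s) μ * μ (ball 0 1) ^ (1 - 1 / s)) ^ (α * s / finrank ℝ E) *
        fractionalMaximal 0 (μ.withDensity h) x ^ (1 - α * s / finrank ℝ E) := by
  set d : ℝ := ((finrank ℝ E : ℕ) : ℝ) with hd
  have hd0 : 0 < d := by rw [hd]; exact_mod_cast finrank_pos (R := ℝ) (M := E)
  set θ := α * s / d with hθ
  have hs0 : 0 < s := by linarith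
  have hθ0 : 0 ≤ θ := by positivity
  have hθ1 : θ ≤ 1 := by
    rw [lt_div_iff₀ hs0] at hαs
    rw [hθ, div_le_one hd0]
    exact hαs.le
  set ν := μ.withDensity h with hν
  set N := eLpNorm h (.ofReal s) μ with hN
  refine iSup₂_le fun r hr => ?_
  have hhol : ν (ball x r) ≤ N * μ (ball x r) ^ (1 - 1 / s) := by
    have := eLpNorm_le_eLpNorm_mul_rpow_measure_univ (μ := μ.restrict (ball x r)) (f := h)
      (p := 1) (q := .ofReal s) (by simpa using hs.le)
      hm.restrict.aestronglyMeasurable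
    rw [eLpNorm_one_eq_lintegral_enorm, Measure.restrict_apply_univ,
      ENNReal.toReal_ofReal hs0.le] at this
    simp only [enorm_eq_self, ENNReal.toReal_one, div_one] at this
    rw [hν, withDensity_apply _ measurableSet_ball]
    exact this.trans (by gcongr; exact eLpNorm_restrict_le _ _ _ _)
  set a := ENNReal.ofReal (r ^ ((0 : ℝ) - d)) * ν (ball x r) with ha
  have ha1 : a ≤ fractionalMaximal 0 ν x :=
    le_iSup₂ (f := fun (r : ℝ) (_ : 0 < r) =>
      ENNReal.ofReal (r ^ ((0 : ℝ) - finrank ℝ E)) * ν (ball x r)) r hr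
  have ha2 : a ≤ N * μ (ball 0 1) ^ (1 - 1 / s) * ENNReal.ofReal (r ^ (-(d / s))) := by
    have hs' : 0 ≤ 1 - 1 / s := by
      rw [sub_nonneg, div_le_one hs0]; exact hs.le
    calc a ≤ ENNReal.ofReal (r ^ ((0 : ℝ) - d)) * (N * μ (ball x r) ^ (1 - 1 / s)) := by
          rw [ha]; gcongr
      _ = N * μ (ball 0 1) ^ (1 - 1 / s) *
          (ENNReal.ofReal (r ^ ((0 : ℝ) - d)) * ENNReal.ofReal ((r ^ d) ^ (1 - 1 / s))) := by
        rw [Measure.addHaar_ball_of_pos μ _ hr, ENNReal.mul_rpow_of_nonneg _ _ hs',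
          ENNReal.ofReal_rpow_of_nonneg (by positivity) hs', hd, Real.rpow_natCast]
        ring
      _ = _ := by
        rw [← ENNReal.ofReal_mul (by positivity), ← Real.rpow_mul hr.le, ← Real.rpow_add hr]
        congr 3
        field_simp
        ring
  -- Split a = a^θ a^(1-θ). Hölder bounds the first factor by a multiple of r^(-θd/s), and θ = αs/d
  -- makes this power cancel r^α; the second factor is bounded by the maximal function.
  calc ENNReal.ofReal (r ^ (α - d)) * ν (ball x r)
      = ENNReal.ofReal (r ^ α) * (a ^ θ * a ^ (1 - θ)) := by
        rw [← ENNReal.rpow_add_of_nonneg _ _ hθ0 (by linarith), add_sub_cancel, ENNReal.rpow_one,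
          ha, ← mul_assoc, ← ENNReal.ofReal_mul (by positivity), ← Real.rpow_add hr]
        congr 3
        ring
    _ ≤ ENNReal.ofReal (r ^ α) *
        ((N * μ (ball 0 1) ^ (1 - 1 / s) * ENNReal.ofReal (r ^ (-(d / s)))) ^ θ *
          fractionalMaximal 0 ν x ^ (1 - θ)) := by
        have : 0 ≤ 1 - θ := by linarith
        gcongr
    _ = (ENNReal.ofReal (r ^ α) * ENNReal.ofReal (r ^ (-α))) *
        ((N * μ (ball 0 1) ^ (1 - 1 / s)) ^ θ * fractionalMaximal 0 ν x ^ (1 - θ)) := by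
        rw [ENNReal.mul_rpow_of_nonneg _ _ hθ0,
          ENNReal.ofReal_rpow_of_nonneg (by positivity) hθ0, ← Real.rpow_mul hr.le]
        have : -(d / s) * θ = -α := by rw [hθ]; field_simp
        rw [this]
        ring
    _ = _ := by
        rw [← ENNReal.ofReal_mul (by positivity), ← Real.rpow_add hr, add_neg_cancel,
          Real.rpow_zero, ENNReal.ofReal_one, one_mul]

/-- The Hardy–Littlewood–Sobolev inequality for the fractional maximal function. -/
theorem eLpNorm_fractionalMaximal_le {s α q : ℝ} (hs : 1 < s) (hα : 0 ≤ α)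
    (hαs : α < finrank ℝ E / s) (hq : 1 / q = 1 / s - α / finrank ℝ E) :
    ∃ C : ℝ≥0∞, C ≠ ⊤ ∧ ∀ h : E → ℝ≥0∞, AEMeasurable h μ → eLpNorm h (.ofReal s) μ ≠ ⊤ →
      eLpNorm (fractionalMaximal α (μ.withDensity h)) (.ofReal q) μ ≤
        C * eLpNorm h (.ofReal s) μ := by
  obtain ⟨C, hC, H⟩ := lintegral_fractionalMaximal_rpow_le μ hs
  set d : ℝ := ((finrank ℝ E : ℕ) : ℝ) with hd
  have hd0 : 0 < d := by rw [hd]; exact_mod_cast finrank_pos (R := ℝ) (M := E)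
  set θ := α * s / d with hθ
  have hs0 : 0 < s := by linarith
  have hθ0 : 0 ≤ θ := by positivity
  have hθ1 : θ < 1 := by
    rw [lt_div_iff₀ hs0] at hαs
    rwa [hθ, div_lt_one hd0]
  have hqθ : 1 / q = (1 - θ) / s := by
    rw [hq, hθ]; field_simp
  have hq0 : 0 < q := by
    rw [← one_div_pos, hqθ]
    exact div_pos (by linarith) hs0
  -- The q-th power of Hedberg's bound therefore contains exactly the s-th power of the maximal
  -- function.
  have hqs : (1 - θ) * q = s := by
    field_simp at hqθ
    linarith
  set κ := μ (ball (0 : E) 1) ^ (1 - 1 / s) with hκ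
  have hs' : 0 ≤ 1 - 1 / s := by
    rw [sub_nonneg, div_le_one hs0]; exact hs.le
  have hκtop : κ ≠ ⊤ := ENNReal.rpow_ne_top_of_nonneg hs' measure_ball_lt_top.ne
  refine ⟨κ ^ θ * C ^ (1 / q), by finiteness, fun h hm hN => ?_⟩
  have hI : eLpNorm h (.ofReal s) μ = (∫⁻ x, h x ^ s ∂μ) ^ (1 / s) := by
    rw [eLpNorm_eq_lintegral_rpow_enorm_toReal (by simpa using hs0) ENNReal.ofReal_ne_top,
      ENNReal.toReal_ofReal hs0.le]
    simp only [enorm_eq_self]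
  set I := ∫⁻ x, h x ^ s ∂μ with hIdef
  have hItop : I ≠ ⊤ := by
    intro htop
    rw [hI, htop, ENNReal.top_rpow_of_pos (by positivity)] at hN
    exact hN rfl
  set N := eLpNorm h (.ofReal s) μ with hNdef
  rw [eLpNorm_eq_lintegral_rpow_enorm_toReal (by simpa using hq0) ENNReal.ofReal_ne_top,
    ENNReal.toReal_ofReal hq0.le]
  simp only [enorm_eq_self]
  calc (∫⁻ x, fractionalMaximal α (μ.withDensity h) x ^ q ∂μ) ^ (1 / q)
      ≤ (∫⁻ x, ((N * κ) ^ θ) ^ q * fractionalMaximal 0 (μ.withDensity h) x ^ s ∂μ) ^ (1 / q) := by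
        gcongr with x
        calc _ ≤ ((N * κ) ^ θ * fractionalMaximal 0 (μ.withDensity h) x ^ (1 - θ)) ^ q := by
              gcongr
              exact fractionalMaximal_le_mul_rpow μ hs hα hαs hm x
          _ = _ := by
              rw [ENNReal.mul_rpow_of_nonneg _ _ hq0.le, ← ENNReal.rpow_mul _ (1 - θ), hqs]
    _ = (((N * κ) ^ θ) ^ q * ∫⁻ x, fractionalMaximal 0 (μ.withDensity h) x ^ s ∂μ) ^ (1 / q) := by
        rw [lintegral_const_mul' _ _ (by finiteness)]
    _ ≤ (((N * κ) ^ θ) ^ q * (C * I)) ^ (1 / q) := by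
        gcongr
        exact H h hm hItop
    _ = κ ^ θ * C ^ (1 / q) * (N ^ θ * I ^ (1 / q)) := by
        rw [ENNReal.mul_rpow_of_nonneg _ _ (by positivity), ← ENNReal.rpow_mul _ q,
          mul_one_div_cancel hq0.ne', ENNReal.rpow_one,
          ENNReal.mul_rpow_of_nonneg N _ hθ0, ENNReal.mul_rpow_of_nonneg C _ (by positivity)]
        ring
    _ = κ ^ θ * C ^ (1 / q) * N := by
        congr 1
        have : I ^ (1 / q) = N ^ (1 - θ) := by
          rw [hI, ← ENNReal.rpow_mul, hqθ]; congr 1; ring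
        rw [this, ← ENNReal.rpow_add_of_nonneg _ _ hθ0 (by linarith), add_sub_cancel,
          ENNReal.rpow_one]

end FractionalIntegration

/-! ### Representing functionals dominated by a weighted L¹ seminorm. -/

section Duality

variable {X : Type*} [MeasurableSpace X]

/-- Every functional of norm at most one on `L¹` of a finite measure is integration against a
function bounded by one. -/
lemma exists_integral_mul_of_dual_L1 (ν : Measure X) [IsFiniteMeasure ν]
    (Λ : StrongDual ℝ (Lp ℝ 1 ν)) (hΛ : ‖Λ‖ ≤ 1) :
    ∃ h : X → ℝ, Measurable h ∧ (∀ x, |h x| ≤ 1) ∧ ∀ f : Lp ℝ 1 ν, Λ f = ∫ x, h x * f x ∂ν := by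
  -- On a finite measure space, multiplication by 1 is the inclusion `J` of L² into L¹. Pulling `Λ`
  -- back along `J` reduces the representation to the Riesz theorem in L².
  let one : Lp ℝ 2 ν := (memLp_const (1 : ℝ)).toLp _
  let J : Lp ℝ 2 ν →L[ℝ] Lp ℝ 1 ν := (ContinuousLinearMap.mul ℝ ℝ).holderL ν 2 2 1 one
  have hJ : ∀ f : Lp ℝ 2 ν, J f =ᵐ[ν] f := by
    intro f
    have h1 := (ContinuousLinearMap.mul ℝ ℝ).coeFn_holder (r := 1) one f
    have h2 : (one : X → ℝ) =ᵐ[ν] fun _ => 1 := MemLp.coeFn_toLp _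
    filter_upwards [h1, h2] with x hx hx2
    rw [show J f = (ContinuousLinearMap.mul ℝ ℝ).holder 1 one f from rfl, hx, hx2]
    simp
  let k : Lp ℝ 2 ν := (InnerProductSpace.toDual ℝ (Lp ℝ 2 ν)).symm (Λ ∘L J)
  have hk : ∀ f : Lp ℝ 2 ν, Λ (J f) = ∫ x, k x * f x ∂ν := by
    intro f
    have h1 : inner ℝ k f = Λ (J f) := by
      simp only [k, InnerProductSpace.toDual_symm_apply]; rfl
    rw [← h1, L2.inner_def]
    refine integral_congr_ae (Eventually.of_forall fun x => ?_)
    simp [mul_comm]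
  have hind : ∀ (s : Set X) (hs : MeasurableSet s) (c : ℝ),
      Λ (indicatorConstLp 1 hs (measure_ne_top ν s) c) = c * ∫ x in s, k x ∂ν := by
    intro s hs c
    have h1 : J (indicatorConstLp 2 hs (measure_ne_top ν s) c) =
        indicatorConstLp 1 hs (measure_ne_top ν s) c := by
      refine Lp.ext ((hJ _).trans ?_)
      exact indicatorConstLp_coeFn.trans indicatorConstLp_coeFn.symm
    rw [← h1, hk, ← integral_const_mul, ← integral_indicator hs]
    refine integral_congr_ae ?_
    filter_upwards [indicatorConstLp_coeFn (p := 2) (hs := hs) (hμs := measure_ne_top ν s)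
      (c := c)] with x hx
    rw [hx]
    by_cases hxs : x ∈ s <;> simp [hxs, mul_comm]
  have kint : Integrable k ν := (Lp.memLp k).integrable (by norm_num)
  -- Testing `Λ` on indicators bounds every set average of `k`, which gives |k| ≤ 1 almost
  -- everywhere.
  have hset : ∀ s, MeasurableSet s → |∫ x in s, k x ∂ν| ≤ ν.real s := by
    intro s hs
    have h1 := hind s hs 1
    rw [one_mul] at h1
    rw [← h1, ← Real.norm_eq_abs]
    refine (Λ.le_opNorm _).trans ?_
    have h2 : ‖indicatorConstLp 1 hs (measure_ne_top ν s) (1 : ℝ)‖ = ν.real s := by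
      rw [norm_indicatorConstLp (by simp) (by simp)]
      simp
    rw [h2]
    exact mul_le_of_le_one_left measureReal_nonneg hΛ
  have hle : k ≤ᵐ[ν] fun _ => (1 : ℝ) := by
    refine ae_le_of_forall_setIntegral_le kint (integrable_const _) fun s hs _ => ?_
    simpa using (le_abs_self _).trans (hset s hs)
  have hge : (fun _ => (-1 : ℝ)) ≤ᵐ[ν] k := by
    refine ae_le_of_forall_setIntegral_le (integrable_const _) kint fun s hs _ => ?_
    have := (abs_le.1 (hset s hs)).1
    simpa using this
  obtain ⟨k', hk'm, hk'⟩ := (Lp.aestronglyMeasurable k)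
  let h : X → ℝ := fun x => max (-1) (min 1 (k' x))
  have hhm : Measurable h := measurable_const.max (measurable_const.min hk'm.measurable)
  have hhb : ∀ x, |h x| ≤ 1 := fun x =>
    abs_le.2 ⟨le_max_left _ _, max_le (by norm_num) (min_le_left _ _)⟩
  have hhk : h =ᵐ[ν] k := by
    filter_upwards [hle, hge, hk'] with x h1 h2 h3
    simp only [h, ← h3, min_eq_right h1, max_eq_right h2]
  refine ⟨h, hhm, hhb, fun f => ?_⟩
  have hmem : MemLp h ⊤ ν := memLp_top_of_bound hhm.aestronglyMeasurable 1
    (Eventually.of_forall fun x => by simpa using hhb x)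
  let Ψ : Lp ℝ 1 ν →L[ℝ] ℝ := (ContinuousLinearMap.mul ℝ ℝ).lpPairing ν ⊤ 1 (hmem.toLp h)
  have hΨ : ∀ f : Lp ℝ 1 ν, Ψ f = ∫ x, h x * f x ∂ν := by
    intro f
    simp only [Ψ, ContinuousLinearMap.lpPairing_eq_integral]
    refine integral_congr_ae ?_
    filter_upwards [hmem.coeFn_toLp] with x hx
    simp [hx]
  rw [← hΨ]
  refine Lp.induction (by simp) (motive := fun f => Λ f = Ψ f) ?_ ?_ ?_ f
  · intro c s hs hμs
    rw [Lp.simpleFunc.coe_indicatorConst, hind, hΨ, ← integral_const_mul, ← integral_indicator hs]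
    refine integral_congr_ae ?_
    filter_upwards [indicatorConstLp_coeFn (p := 1) (hs := hs) (hμs := hμs.ne) (c := c), hhk]
      with x hx hx2
    rw [hx, hx2]
    by_cases hxs : x ∈ s <;> simp [hxs, mul_comm]
  · intro f g hf hg _ h1 h2
    rw [map_add, map_add, h1, h2]
  · exact isClosed_eq Λ.continuous Ψ.continuous

/-- A linear functional on a space of functions which is dominated by a weighted `L¹` seminorm
with weight `G` is integration against a function bounded by `G`. -/
lemma exists_integral_mul_of_le_lintegral (μ : Measure X) [SigmaFinite μ] {G : X → NNReal}
    (hG : Measurable G) (V : Submodule ℝ (X → ℝ)) (hV : ∀ φ ∈ V, Measurable φ)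
    (hV' : ∀ φ ∈ V, ∫⁻ x, G x * ‖φ x‖ₑ ∂μ ≠ ⊤) (Λ : V →ₗ[ℝ] ℝ)
    (hΛ : ∀ φ : V, ‖Λ φ‖ₑ ≤ ∫⁻ x, G x * ‖(φ : X → ℝ) x‖ₑ ∂μ) :
    ∃ g : X → ℝ, Measurable g ∧ (∀ x, |g x| ≤ G x) ∧
      ∀ φ : V, Λ φ = ∫ x, g x * (φ : X → ℝ) x ∂μ := by
  -- The weight `G` need not be integrable. A positive `m` with ∫ G m dμ < 1 makes ν = G m μ finite,
  -- and φ ↦ φ/m turns the G-weighted seminorm into the L¹(ν) norm.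
  obtain ⟨m, hm0, hmm, hmlt⟩ := exists_pos_lintegral_lt_of_sigmaFinite
    (μ.withDensity fun x => (G x : ℝ≥0∞)) one_ne_zero
  let ν := μ.withDensity fun x => ((G x * m x : NNReal) : ℝ≥0∞)
  have hGm : Measurable fun x => G x * m x := hG.mul hmm
  have : IsFiniteMeasure ν := by
    refine ⟨?_⟩
    rw [lintegral_withDensity_eq_lintegral_mul _ hG.coe_nnreal_ennreal hmm.coe_nnreal_ennreal]
      at hmlt
    rw [withDensity_apply _ MeasurableSet.univ, Measure.restrict_univ]
    refine lt_of_eq_of_lt (lintegral_congr fun x => ?_) (hmlt.trans ENNReal.one_lt_top)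
    simp
  have hnorm : ∀ φ : X → ℝ, Measurable φ →
      ∫⁻ x, ‖φ x / m x‖ₑ ∂ν = ∫⁻ x, G x * ‖φ x‖ₑ ∂μ := by
    intro φ hφ
    rw [lintegral_withDensity_eq_lintegral_mul _ hGm.coe_nnreal_ennreal (by fun_prop)]
    refine lintegral_congr fun x => ?_
    have hx : (m x : ℝ≥0∞) ≠ 0 := by simpa using (hm0 x).ne'
    have hx' : ‖(m x : ℝ)‖ₑ = m x := by simp
    have hr : (m x : ℝ) ≠ 0 := by exact_mod_cast (hm0 x).ne'
    have : ‖φ x‖ₑ = ‖φ x / m x‖ₑ * m x := by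
      rw [← hx', ← enorm_mul, div_mul_cancel₀ _ hr]
    rw [Pi.mul_apply, this, ENNReal.coe_mul]
    ring
  have hmem : ∀ φ : V, MemLp (fun x => (φ : X → ℝ) x / m x) 1 ν := by
    intro φ
    refine ⟨((hV φ φ.2).div hmm.coe_nnreal_real).aestronglyMeasurable, ?_⟩
    rw [eLpNorm_one_eq_lintegral_enorm, hnorm _ (hV φ φ.2)]
    exact (hV' φ φ.2).lt_top
  let T : V →ₗ[ℝ] Lp ℝ 1 ν :=
    { toFun := fun φ => (hmem φ).toLp _
      map_add' := fun φ ψ => by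
        rw [← MemLp.toLp_add]
        exact MemLp.toLp_congr _ _ (Eventually.of_forall fun x => by simp [add_div])
      map_smul' := fun c φ => by
        rw [RingHom.id_apply, ← MemLp.toLp_const_smul]
        exact MemLp.toLp_congr _ _ (Eventually.of_forall fun x => by simp [mul_div_assoc]) }
  have hT : ∀ φ : V, ‖T φ‖ₑ = ∫⁻ x, G x * ‖(φ : X → ℝ) x‖ₑ ∂μ := by
    intro φ
    rw [← hnorm _ (hV φ φ.2), ← eLpNorm_one_eq_lintegral_enorm]
    exact Lp.enorm_toLp (hmem φ)
  have hΛT : ∀ φ : V, ‖Λ φ‖ ≤ ‖T φ‖ := by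
    intro φ
    rw [← enorm_le_iff_norm_le, hT]
    exact hΛ φ
  have : Module.Free ℝ (LinearMap.range T) := Module.Free.of_divisionRing ℝ _
  have : Module.Projective ℝ (LinearMap.range T) := Module.Projective.of_free
  -- `T` may fail to be injective. The functional still descends to its range, because `hΛT` makes
  -- `Λ` vanish on the kernel; a linear section then defines it there, ready for Hahn–Banach.
  obtain ⟨σ, hσ⟩ := T.rangeRestrict.exists_rightInverse_of_surjective T.range_rangeRestrict
  have hσ' : ∀ u : LinearMap.range T, T (σ u) = u := fun u =>
    congrArg Subtype.val (LinearMap.congr_fun hσ u)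
  let Λ₀ : StrongDual ℝ (LinearMap.range T) :=
    LinearMap.mkContinuous (Λ ∘ₗ σ) 1 fun u => by
      rw [one_mul, LinearMap.comp_apply]
      refine (hΛT _).trans ?_
      rw [hσ']
      rfl
  obtain ⟨Λ₁, hΛ₁, hΛ₁n⟩ := exists_extension_norm_eq (LinearMap.range T) Λ₀
  obtain ⟨h, hhm, hhb, hh⟩ := exists_integral_mul_of_dual_L1 ν Λ₁
    (hΛ₁n.le.trans (LinearMap.mkContinuous_norm_le _ zero_le_one _))
  refine ⟨fun x => h x * G x, hhm.mul hG.coe_nnreal_real, fun x => ?_, fun φ => ?_⟩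
  · rw [abs_mul, NNReal.abs_eq]
    exact mul_le_of_le_one_left (G x).2 (hhb x)
  have h1 : Λ φ = Λ₁ (T φ) := by
    have h2 := hΛ₁ ⟨T φ, LinearMap.mem_range_self T φ⟩
    rw [h2]
    have h3 := hΛT (φ - σ ⟨T φ, LinearMap.mem_range_self T φ⟩)
    rw [map_sub T, hσ', sub_self, norm_zero, norm_le_zero_iff, map_sub, sub_eq_zero] at h3
    exact h3
  rw [h1, hh]
  have h2 : ∫ x, h x * T φ x ∂ν = ∫ x, h x * ((φ : X → ℝ) x / m x) ∂ν := by
    refine integral_congr_ae ?_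
    filter_upwards [(hmem φ).coeFn_toLp] with x hx
    rw [← hx]
    rfl
  rw [h2, integral_withDensity_eq_integral_smul hGm]
  refine integral_congr_ae (Eventually.of_forall fun x => ?_)
  have hr : (m x : ℝ) ≠ 0 := by exact_mod_cast (hm0 x).ne'
  simp only [NNReal.smul_def, NNReal.coe_mul, smul_eq_mul]
  field_simp

end Duality

/-! ### From a bound along segments to a bound on distributional derivatives. -/

lemma enorm_toReal_sub_toReal_le {a b c d : ℝ≥0∞} (ha : a ≠ ⊤) (hb : b ≠ ⊤)
    (hab : a ≤ b + c) (hba : b ≤ a + d) : ‖a.toReal - b.toReal‖ₑ ≤ c + d := by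
  rw [← edist_eq_enorm_sub, edist_dist, Real.dist_eq]
  rcases le_total a b with h | h
  · rw [abs_sub_comm, abs_of_nonneg (sub_nonneg.2 (ENNReal.toReal_mono hb h)),
      ← ENNReal.toReal_sub_of_le h hb, ENNReal.ofReal_toReal (ENNReal.sub_ne_top hb)]
    exact (tsub_le_iff_left.2 hba).trans le_add_self
  · rw [abs_of_nonneg (sub_nonneg.2 (ENNReal.toReal_mono ha h)),
      ← ENNReal.toReal_sub_of_le h ha, ENNReal.ofReal_toReal (ENNReal.sub_ne_top ha)]
    exact (tsub_le_iff_left.2 hab).trans le_self_add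

section SegmentBound

variable {E : Type*} [NormedAddCommGroup E] [MeasurableSpace E] [BorelSpace E] (μ : Measure E)

/-- Translating back moves the shift onto `φ`, which changes by at most L‖v‖ and stays supported in
the δ-neighbourhood. The error is linear in ‖v‖, so it disappears in the limit of difference
quotients. -/
lemma lintegral_enorm_mul_translate_le [μ.IsAddRightInvariant] {G : E → ℝ≥0∞} (hG : Measurable G)
    {φ : E → ℝ} {L : NNReal} (hφL : LipschitzWith L φ)
    {δ : ℝ} {v : E} (hv : ‖v‖ ≤ δ) :
    ∫⁻ x, ‖φ x‖ₑ * G (x - v) ∂μ ≤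
      ∫⁻ x in cthickening δ (tsupport φ), ‖φ x‖ₑ * G x ∂μ +
        L * ‖v‖ₑ * ∫⁻ x in cthickening δ (tsupport φ), G x ∂μ := by
  rw [← lintegral_add_right_eq_self _ v]
  simp only [add_sub_cancel_right]
  have hK' : MeasurableSet (cthickening δ (tsupport φ)) := isClosed_cthickening.measurableSet
  have h0 : ∀ x, x ∉ cthickening δ (tsupport φ) → φ (x + v) = 0 := by
    intro x hx
    by_contra hne
    refine hx (mem_cthickening_of_dist_le x (x + v) δ _ (subset_tsupport φ hne) ?_)
    simpa using hv
  rw [← lintegral_const_mul' _ _ (by finiteness)]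
  calc ∫⁻ x, ‖φ (x + v)‖ₑ * G x ∂μ
      = ∫⁻ x in cthickening δ (tsupport φ), ‖φ (x + v)‖ₑ * G x ∂μ := by
        rw [← lintegral_indicator hK']
        refine lintegral_congr fun x => ?_
        by_cases hx : x ∈ cthickening δ (tsupport φ)
        · rw [indicator_of_mem hx]
        · rw [indicator_of_notMem hx, h0 x hx]; simp
    _ ≤ ∫⁻ x in cthickening δ (tsupport φ), (‖φ x‖ₑ * G x + L * ‖v‖ₑ * G x) ∂μ := by
        refine lintegral_mono fun x => ?_
        rw [← add_mul]
        gcongr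
        have h1 := hφL (x + v) x
        rw [edist_eq_enorm_sub, edist_eq_enorm_sub, add_sub_cancel_left] at h1
        calc ‖φ (x + v)‖ₑ = ‖φ x + (φ (x + v) - φ x)‖ₑ := by rw [add_sub_cancel]
          _ ≤ _ := (enorm_add_le _ _).trans (by gcongr)
    _ ≤ _ := by
        have hφm : Measurable φ := hφL.continuous.measurable
        rw [lintegral_add_left (by fun_prop)]

variable [NormedSpace ℝ E] [FiniteDimensional ℝ E] [μ.IsAddHaarMeasure]

/-- If `F` varies along short segments in `Ω` by at most the integral of `G`, then its distributional
directional derivatives are dominated by `2 G`. -/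
lemma enorm_integral_mul_lineDeriv_le {Ω : Set E} (hΩ : IsOpen Ω) {F G : E → ℝ≥0∞}
    (hG : Measurable G) (hGK : ∀ K ⊆ Ω, IsCompact K → ∫⁻ x in K, G x ∂μ ≠ ⊤)
    (hF : ∀ᵐ x ∂μ, x ∈ Ω → F x ≠ ⊤)
    (hFint : LocallyIntegrableOn (fun x => (F x).toReal) Ω μ)
    (hFG : ∀ x y, ENNReal.ofReal (dist x y) < infEDist x Ωᶜ →
      F x ≤ F y + ENNReal.ofReal (dist x y) * ∫⁻ t in Icc (0 : ℝ) 1, G (x + t • (y - x)))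
    {φ : E → ℝ} (hφ : ContDiff ℝ ∞ φ) (hc : HasCompactSupport φ) (hs : tsupport φ ⊆ Ω)
    {e : E} (he : ‖e‖ = 1) :
    ‖∫ x in Ω, (F x).toReal * fderiv ℝ φ x e ∂μ‖ₑ ≤ 2 * ∫⁻ x in Ω, G x * ‖φ x‖ₑ ∂μ := by
  obtain ⟨δ, hδ, hδΩ⟩ := hc.isCompact.exists_cthickening_subset_open hΩ hs
  set K := tsupport φ with hK
  set K' := cthickening δ K with hK'
  have hK'c : IsCompact K' := hc.isCompact.cthickening
  have hK'm : MeasurableSet K' := isClosed_cthickening.measurableSet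
  obtain ⟨L, hL⟩ : ∃ L, LipschitzWith L φ :=
    hφ.lipschitzWith_of_hasCompactSupport hc (by simp)
  -- The cut-off makes the function globally integrable without changing it near the support of `φ`.
  set u := K'.indicator fun x => (F x).toReal with hu
  have hui : Integrable u μ :=
    (hFint.integrableOn_compact_subset hδΩ hK'c).integrable_indicator hK'm
  have hlim := hL.integral_inv_smul_sub_mul_tendsto_integral_lineDeriv_mul hui e
  have hder : ∀ x, lineDeriv ℝ φ x e = fderiv ℝ φ x e := fun x =>
    ((hφ.differentiable (by simp)) x).lineDeriv_eq_fderiv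
  have hlhs : ∫ x, lineDeriv ℝ φ x e * u x ∂μ = ∫ x in Ω, (F x).toReal * fderiv ℝ φ x e ∂μ := by
    rw [← integral_indicator hΩ.measurableSet]
    refine integral_congr_ae (Eventually.of_forall fun x => ?_)
    simp only [hder, hu]
    by_cases hx : x ∈ K
    · have h1 : x ∈ K' := self_subset_cthickening _ hx
      rw [indicator_of_mem h1, indicator_of_mem (hδΩ h1), mul_comm]
    · have : fderiv ℝ φ x = 0 := by
        by_contra hne
        exact hx (support_fderiv_subset ℝ hne)
      by_cases hx' : x ∈ Ω <;> simp [this, hx']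
  rw [hlhs] at hlim
  set A := ∫⁻ x in K', ‖φ x‖ₑ * G x ∂μ with hA
  set B := ∫⁻ x in K', G x ∂μ with hB
  have hBtop : B ≠ ⊤ := hGK K' hδΩ hK'c
  have hAle : A ≤ ∫⁻ x in Ω, G x * ‖φ x‖ₑ ∂μ := by
    simp only [hA, mul_comm (‖φ _‖ₑ)]
    exact lintegral_mono_set hδΩ
  have hinf : ∀ x ∈ K, ENNReal.ofReal δ ≤ infEDist x Ωᶜ := by
    intro x hx
    refine le_infEDist.2 fun z hz => ?_
    by_contra hcon
    rw [not_le, edist_dist, ENNReal.ofReal_lt_ofReal_iff hδ] at hcon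
    refine hz (hδΩ (mem_cthickening_of_dist_le z x δ _ hx ?_))
    rw [dist_comm]; exact hcon.le
  -- The difference quotient is moved from `φ` to `u` by translation. With t < δ/2, both x and x -
  -- te are farther than `t` from the complement of Ω, so the segment bound applies in both
  -- directions; their sum is the source of the factor 2.
  have hbound : ∀ t : ℝ, 0 < t → t < δ / 2 →
      ‖∫ x, (t⁻¹ • (φ (x + t • e) - φ x)) * u x ∂μ‖ₑ ≤ 2 * (A + L * ENNReal.ofReal t * B) := by
    intro t ht htδ
    have hte : ‖t • e‖ = t := by rw [norm_smul, he, mul_one, Real.norm_of_nonneg ht.le]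
    have hφb : ∃ C, ∀ x, ‖φ x‖ ≤ C := hc.exists_bound_of_continuous hφ.continuous
    obtain ⟨Cφ, hCφ⟩ := hφb
    have i1 : Integrable (fun x => φ x * u x) μ :=
      hui.bdd_mul hφ.continuous.aestronglyMeasurable (Eventually.of_forall hCφ)
    have hui' : Integrable (fun x => u (x - t • e)) μ := hui.comp_sub_right (t • e)
    have i2 : Integrable (fun x => φ x * u (x - t • e)) μ :=
      hui'.bdd_mul hφ.continuous.aestronglyMeasurable (Eventually.of_forall hCφ)
    have i3 : Integrable (fun x => φ (x + t • e) * u x) μ := by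
      simpa using i2.comp_add_right (t • e)
    have e1 : ∫ x, (t⁻¹ • (φ (x + t • e) - φ x)) * u x ∂μ =
        t⁻¹ * ∫ x, φ x * (u (x - t • e) - u x) ∂μ := by
      have e2 : ∫ x, φ (x + t • e) * u x ∂μ = ∫ x, φ x * u (x - t • e) ∂μ := by
        rw [← integral_add_right_eq_self (fun x => φ x * u (x - t • e)) (t • e)]; simp
      calc _ = ∫ x, t⁻¹ * (φ (x + t • e) * u x - φ x * u x) ∂μ := by
            refine integral_congr_ae (Eventually.of_forall fun x => ?_)
            simp only [smul_eq_mul]; ring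
        _ = t⁻¹ * (∫ x, φ x * u (x - t • e) ∂μ - ∫ x, φ x * u x ∂μ) := by
            rw [integral_const_mul, integral_sub i3 i1, e2]
        _ = _ := by
            rw [← integral_sub i2 i1]
            simp only [mul_sub]
    have hFt : ∀ᵐ x ∂μ, x - t • e ∈ Ω → F (x - t • e) ≠ ⊤ := by
      have := (measurePreserving_sub_right μ (t • e)).quasiMeasurePreserving.ae hF
      simpa using this
    have hpt : ∀ᵐ x ∂μ, ‖φ x * (u (x - t • e) - u x)‖ₑ ≤
        ∫⁻ s in Icc (0 : ℝ) 1, ENNReal.ofReal t *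
          (‖φ x‖ₑ * G (x - (s * t) • e) + ‖φ x‖ₑ * G (x - ((1 - s) * t) • e)) := by
      filter_upwards [hF, hFt] with x h1 h2
      by_cases hx : x ∈ K
      swap
      · rw [image_eq_zero_of_notMem_tsupport hx]; simp
      have hxK' : x ∈ K' := self_subset_cthickening _ hx
      have hd : dist x (x - t • e) = t := by simp [hte]
      have hd' : dist (x - t • e) x = t := by rw [dist_comm]; exact hd
      have hyK' : x - t • e ∈ K' :=
        mem_cthickening_of_dist_le _ x δ _ hx (by rw [hd']; linarith)
      have hF1 := h1 (hδΩ hxK')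
      have hF2 := h2 (hδΩ hyK')
      have g1 := hFG x (x - t • e) (by
        rw [hd]
        refine lt_of_lt_of_le ?_ (hinf x hx)
        rw [ENNReal.ofReal_lt_ofReal_iff hδ]; linarith)
      have g2 := hFG (x - t • e) x (by
        rw [hd']
        have h3 : infEDist x Ωᶜ ≤ edist x (x - t • e) + infEDist (x - t • e) Ωᶜ := by
          rw [add_comm]; exact infEDist_le_infEDist_add_edist
        have h4 := (hinf x hx).trans h3
        rw [edist_dist, hd] at h4
        by_contra hcon
        have h5 := h4.trans (add_le_add_right (not_lt.1 hcon) _)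
        rw [← ENNReal.ofReal_add ht.le ht.le, ENNReal.ofReal_le_ofReal_iff (by linarith)] at h5
        linarith)
      rw [hd] at g1
      rw [hd'] at g2
      have g3 := enorm_toReal_sub_toReal_le hF2 hF1 g2 g1
      rw [hu, indicator_of_mem hxK', indicator_of_mem hyK', enorm_mul]
      refine (mul_le_mul_right g3 _).trans_eq ?_
      have m1 : Measurable fun s : ℝ => G (x - t • e + s • (x - (x - t • e))) := by fun_prop
      have m2 : Measurable fun s : ℝ => G (x - (s * t) • e) := by fun_prop
      have m3 : Measurable fun s : ℝ => G (x - ((1 - s) * t) • e) := by fun_prop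
      have e3 : ∀ s : ℝ, x + s • (x - t • e - x) = x - (s * t) • e := by
        intro s; rw [mul_smul]; module
      have e4 : ∀ s : ℝ, x - t • e + s • (x - (x - t • e)) = x - ((1 - s) * t) • e := by
        intro s; module
      simp only [e3, e4]
      rw [lintegral_const_mul _ (by fun_prop), lintegral_add_left (by fun_prop),
        lintegral_const_mul _ m2, lintegral_const_mul _ m3]
      ring
    rw [e1, enorm_mul, enorm_inv ht.ne', Real.enorm_of_nonneg ht.le]
    have hφm : Measurable φ := hφ.continuous.measurable
    have hmain : ‖∫ x, φ x * (u (x - t • e) - u x) ∂μ‖ₑ ≤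
        ENNReal.ofReal t * (2 * (A + L * ENNReal.ofReal t * B)) := by
      calc _ ≤ ∫⁻ x, ‖φ x * (u (x - t • e) - u x)‖ₑ ∂μ := enorm_integral_le_lintegral_enorm _
        _ ≤ ∫⁻ x, (∫⁻ s in Icc (0 : ℝ) 1, ENNReal.ofReal t *
            (‖φ x‖ₑ * G (x - (s * t) • e) + ‖φ x‖ₑ * G (x - ((1 - s) * t) • e))) ∂μ :=
          lintegral_mono_ae hpt
        _ = ∫⁻ s in Icc (0 : ℝ) 1, (∫⁻ x, ENNReal.ofReal t *
            (‖φ x‖ₑ * G (x - (s * t) • e) + ‖φ x‖ₑ * G (x - ((1 - s) * t) • e)) ∂μ) := by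
          refine lintegral_lintegral_swap (Measurable.aemeasurable ?_)
          fun_prop
        _ ≤ ∫⁻ s in Icc (0 : ℝ) 1, ENNReal.ofReal t * (2 * (A + L * ENNReal.ofReal t * B)) := by
          refine setLIntegral_mono measurable_const fun s hs => ?_
          rw [lintegral_const_mul _ (by fun_prop), lintegral_add_left (by fun_prop), two_mul]
          have key : ∀ r : ℝ, 0 ≤ r → r ≤ 1 → ∫⁻ x, ‖φ x‖ₑ * G (x - (r * t) • e) ∂μ ≤
              A + L * ENNReal.ofReal t * B := by
            intro r hr0 hr1
            have hn : ‖(r * t) • e‖ = r * t := by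
              rw [norm_smul, he, mul_one, Real.norm_of_nonneg (by positivity)]
            refine (lintegral_enorm_mul_translate_le μ hG hL (δ := δ)
              (by rw [hn]; nlinarith)).trans ?_
            gcongr
            rw [← ofReal_norm, hn]
            exact ENNReal.ofReal_le_ofReal (by nlinarith)
          gcongr
          · exact key s hs.1 hs.2
          · exact key (1 - s) (by linarith [hs.2]) (by linarith [hs.1])
        _ = _ := by simp
    calc _ ≤ (ENNReal.ofReal t)⁻¹ *
          (ENNReal.ofReal t * (2 * (A + L * ENNReal.ofReal t * B))) := by gcongr
      _ = _ := by
        rw [← mul_assoc, ENNReal.inv_mul_cancel (by simpa using ht) ENNReal.ofReal_ne_top, one_mul]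
  have hrhs : Tendsto (fun t : ℝ => 2 * (A + L * ENNReal.ofReal t * B)) (𝓝[>] 0)
      (𝓝 (2 * (A + L * ENNReal.ofReal 0 * B))) := by
    refine Tendsto.mono_left ?_ nhdsWithin_le_nhds
    refine ENNReal.Tendsto.const_mul (tendsto_const_nhds.add ?_) (Or.inr ENNReal.ofNat_ne_top)
    refine ENNReal.Tendsto.mul_const ?_ (Or.inr hBtop)
    exact ENNReal.Tendsto.const_mul (ENNReal.tendsto_ofReal tendsto_id)
      (Or.inr ENNReal.coe_ne_top)
  have := le_of_tendsto_of_tendsto hlim.enorm hrhs (by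
    filter_upwards [Ioo_mem_nhdsGT (half_pos hδ)] with t ht
    exact hbound t ht.1 ht.2)
  simp only [ENNReal.ofReal_zero, mul_zero, zero_mul, add_zero] at this
  exact this.trans (by gcongr)

end SegmentBound

/-! ### Constructing the weak gradient from the segment bound. -/

section WeakGradient

/-- The space of test functions on `Ω`. -/
def testFunctions {n : ℕ} (Ω : Set (EuclideanSpace ℝ (Fin n))) :
    Submodule ℝ (EuclideanSpace ℝ (Fin n) → ℝ) where
  carrier := {φ | ContDiff ℝ ∞ φ ∧ HasCompactSupport φ ∧ tsupport φ ⊆ Ω}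
  add_mem' := fun ⟨h1, h2, h3⟩ ⟨k1, k2, k3⟩ =>
    ⟨h1.add k1, h2.add k2, (tsupport_add _ _).trans (union_subset h3 k3)⟩
  zero_mem' := ⟨contDiff_const, HasCompactSupport.zero, by simp⟩
  smul_mem' := fun c φ ⟨h1, h2, h3⟩ =>
    ⟨h1.const_smul c, h2.smul_left (f := fun _ => c),
      (closure_mono (Function.support_const_smul_subset c φ)).trans h3⟩

variable {n : ℕ} {Ω : Set (EuclideanSpace ℝ (Fin n))}

lemma integrableOn_mul_of_tsupport_subset (hΩ : IsOpen Ω) {u φ : EuclideanSpace ℝ (Fin n) → ℝ}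
    (hu : LocallyIntegrableOn u Ω) (hφ : Continuous φ) (hc : HasCompactSupport φ)
    (hs : tsupport φ ⊆ Ω) : IntegrableOn (fun x => u x * φ x) Ω := by
  have h1 : IntegrableOn u (tsupport φ) := hu.integrableOn_compact_subset hs hc
  have h2 : IntegrableOn (fun x => u x * φ x) (tsupport φ) :=
    h1.mul_continuousOn hφ.continuousOn hc
  refine IntegrableOn.of_forall_sdiff_eq_zero h2 hΩ.measurableSet ?_
  intro x hx
  simp [image_eq_zero_of_notMem_tsupport hx.2]

/-- A function which varies along short segments in `Ω` by at most the integral of `G` has a weak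
gradient dominated by `G`. -/
theorem exists_hasWeakGradient_of_segment_bound (hΩ : IsOpen Ω)
    {F G : EuclideanSpace ℝ (Fin n) → ℝ≥0∞} (hG : Measurable G)
    (hGK : ∀ K ⊆ Ω, IsCompact K → ∫⁻ x in K, G x ≠ ⊤) (hGfin : ∀ᵐ x, G x ≠ ⊤)
    (hF : ∀ᵐ x, x ∈ Ω → F x ≠ ⊤)
    (hFint : LocallyIntegrableOn (fun x => (F x).toReal) Ω)
    (hFG : ∀ x y, ENNReal.ofReal (dist x y) < infEDist x Ωᶜ →
      F x ≤ F y + ENNReal.ofReal (dist x y) * ∫⁻ t in Icc (0 : ℝ) 1, G (x + t • (y - x))) :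
    ∃ g : EuclideanSpace ℝ (Fin n) → EuclideanSpace ℝ (Fin n), Measurable g ∧
      HasWeakGradient Ω (fun x => (F x).toReal) g ∧ ∀ᵐ x, ‖g x‖ₑ ≤ 2 * n * G x := by
  set G' : EuclideanSpace ℝ (Fin n) → NNReal := fun x => 2 * (G x).toNNReal with hG'
  have hG'm : Measurable G' := hG.ennreal_toNNReal.const_mul 2
  have hG'G : ∀ᵐ x, (G' x : ℝ≥0∞) = 2 * G x := by
    filter_upwards [hGfin] with x hx
    simp [hG', ENNReal.coe_toNNReal hx]
  have hfd : ∀ φ ∈ testFunctions Ω, ∀ e, IntegrableOn (fun x => (F x).toReal * fderiv ℝ φ x e) Ω := by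
    intro φ hφ e
    have hsupp : tsupport (fun x => fderiv ℝ φ x e) ⊆ tsupport φ := tsupport_fderiv_apply_subset ℝ e
    exact integrableOn_mul_of_tsupport_subset hΩ hFint
      ((hφ.1.continuous_fderiv (by simp)).clm_apply continuous_const)
      (hφ.2.1.mono' (subset_closure.trans hsupp)) (hsupp.trans hφ.2.2)
  have hdiff : ∀ φ ∈ testFunctions Ω, Differentiable ℝ φ := fun φ hφ =>
    hφ.1.differentiable (by simp)
  let Λ : EuclideanSpace ℝ (Fin n) → testFunctions Ω →ₗ[ℝ] ℝ := fun e =>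
    { toFun := fun φ => - ∫ x in Ω, (F x).toReal * fderiv ℝ φ x e
      map_add' := fun φ ψ => by
        rw [← neg_add, ← integral_add (hfd φ φ.2 e) (hfd ψ ψ.2 e)]
        congr 1
        refine integral_congr_ae (Eventually.of_forall fun x => ?_)
        simp only [Submodule.coe_add, fderiv_add (hdiff φ φ.2 x) (hdiff ψ ψ.2 x),
          add_apply, mul_add]
      map_smul' := fun c φ => by
        rw [RingHom.id_apply, smul_neg, ← integral_smul]
        congr 1
        refine integral_congr_ae (Eventually.of_forall fun x => ?_)
        simp only [Submodule.coe_smul, fderiv_const_smul (hdiff φ φ.2 x),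
          smul_apply, smul_eq_mul]
        ring }
  have hGφ : ∀ φ : EuclideanSpace ℝ (Fin n) → ℝ, Measurable φ →
      ∫⁻ x in Ω, G' x * ‖φ x‖ₑ = 2 * ∫⁻ x in Ω, G x * ‖φ x‖ₑ := by
    intro φ hφ
    rw [← lintegral_const_mul _ (by fun_prop)]
    refine lintegral_congr_ae (ae_restrict_of_ae ?_)
    filter_upwards [hG'G] with x hx
    rw [hx]; ring
  have hloc : ∀ K ⊆ Ω, IsCompact K → ∫⁻ x in K, (G' x : ℝ≥0∞) ≠ ⊤ := by
    intro K hK hKc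
    rw [lintegral_congr_ae (ae_restrict_of_ae hG'G), lintegral_const_mul _ hG]
    exact ENNReal.mul_ne_top ENNReal.ofNat_ne_top (hGK K hK hKc)
  have hfin : ∀ φ ∈ testFunctions Ω, ∫⁻ x in Ω, G' x * ‖φ x‖ₑ ≠ ⊤ := by
    intro φ hφ
    obtain ⟨C, hC⟩ := hφ.2.1.exists_bound_of_continuous hφ.1.continuous
    have h1 : ∫⁻ x in Ω, G' x * ‖φ x‖ₑ ≤ ∫⁻ x in tsupport φ, G' x * ENNReal.ofReal C := by
      rw [← lintegral_indicator (isClosed_tsupport φ).measurableSet,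
        ← lintegral_indicator hΩ.measurableSet]
      refine lintegral_mono fun x => ?_
      by_cases hx : x ∈ tsupport φ
      · rw [indicator_of_mem (hφ.2.2 hx), indicator_of_mem hx, ← ofReal_norm]
        gcongr
        exact hC x
      · by_cases hx' : x ∈ Ω <;>
        simp [hx, hx', image_eq_zero_of_notMem_tsupport hx]
    refine ne_top_of_le_ne_top ?_ h1
    rw [lintegral_mul_const _ (by fun_prop)]
    exact ENNReal.mul_ne_top (hloc _ hφ.2.2 hφ.2.1.isCompact) ENNReal.ofReal_ne_top
  -- The i-th distributional derivative is dominated by the L¹ seminorm with weight 2G on test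
  -- functions, so duality turns it into a function.
  have key : ∀ i : Fin n, ∃ g : EuclideanSpace ℝ (Fin n) → ℝ, Measurable g ∧
      (∀ x, |g x| ≤ G' x) ∧ ∀ φ : testFunctions Ω,
        Λ (EuclideanSpace.single i 1) φ = ∫ x in Ω, g x * (φ : _ → ℝ) x := by
    intro i
    refine exists_integral_mul_of_le_lintegral (volume.restrict Ω) hG'm (testFunctions Ω)
      (fun φ hφ => hφ.1.continuous.measurable) hfin _ fun φ => ?_
    rw [hGφ _ φ.2.1.continuous.measurable]
    simp only [Λ, LinearMap.coe_mk, AddHom.coe_mk, enorm_neg]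
    exact enorm_integral_mul_lineDeriv_le volume hΩ hG hGK hF hFint hFG φ.2.1 φ.2.2.1 φ.2.2.2
      (by simp)
  choose g hgm hgb hg using key
  let g' : EuclideanSpace ℝ (Fin n) → EuclideanSpace ℝ (Fin n) :=
    fun x => WithLp.toLp 2 fun i => g i x
  have hg'm : Measurable g' :=
    (PiLp.continuous_toLp 2 _).measurable.comp (measurable_pi_lambda _ fun i => hgm i)
  have hg'n : ∀ x, ‖g' x‖ₑ ≤ n * G' x := by
    intro x
    have h1 : ‖g' x‖ ≤ ∑ i : Fin n, ‖g i x‖ := by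
      have h2 : g' x = ∑ i : Fin n, EuclideanSpace.single i (g i x) := by
        ext j
        simp [g']
      rw [h2]
      refine (norm_sum_le _ _).trans (le_of_eq (Finset.sum_congr rfl fun i _ => ?_))
      simp
    have h3 : ‖g' x‖ ≤ n * G' x := by
      refine h1.trans ((Finset.sum_le_sum fun i _ => hgb i x).trans_eq ?_)
      simp
    rw [← ofReal_norm]
    refine (ENNReal.ofReal_le_ofReal h3).trans_eq ?_
    rw [ENNReal.ofReal_mul (by positivity)]
    simp
  refine ⟨g', hg'm, ⟨hFint, ?_, ?_⟩, ?_⟩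
  · rw [locallyIntegrableOn_iff hΩ.isLocallyClosed]
    intro K hK hKc
    refine ⟨hg'm.aestronglyMeasurable, ?_⟩
    refine (lintegral_mono fun x => hg'n x).trans_lt ?_
    rw [lintegral_const_mul' _ _ (by finiteness)]
    exact ENNReal.mul_lt_top (by finiteness) (hloc K hK hKc).lt_top
  · intro φ h1 h2 h3 i
    have := hg i ⟨φ, h1, h2, h3⟩
    simp only [Λ, LinearMap.coe_mk, AddHom.coe_mk] at this
    rw [← neg_eq_iff_eq_neg, this]
  · filter_upwards [hG'G] with x hx
    refine (hg'n x).trans_eq ?_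
    rw [hx]; ring

end WeakGradient

/-! ### Mollification in L¹. -/

section Mollifier

variable {E : Type*} [NormedAddCommGroup E] [NormedSpace ℝ E] [MeasurableSpace E] [BorelSpace E]
  [FiniteDimensional ℝ E] (μ : Measure E) [μ.IsAddHaarMeasure]
  {E' : Type*} [NormedAddCommGroup E'] [NormedSpace ℝ E']

open ContinuousLinearMap (lsmul)
open scoped Convolution

/-- Tonelli, translation invariance and the unit mass of the mollifier. -/
lemma lintegral_enorm_normed_convolution_le (φ : ContDiffBump (0 : E)) {u : E → E'}
    (hu : AEStronglyMeasurable u μ) :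
    ∫⁻ x, ‖(φ.normed μ ⋆[lsmul ℝ ℝ, μ] u) x‖ₑ ∂μ ≤ ∫⁻ x, ‖u x‖ₑ ∂μ := by
  have h1 : ∫⁻ t, ‖φ.normed μ t‖ₑ ∂μ = 1 := by
    have h2 := ofReal_integral_eq_lintegral_ofReal φ.integrable_normed
      (Eventually.of_forall φ.nonneg_normed) (μ := μ)
    rw [φ.integral_normed, ENNReal.ofReal_one] at h2
    rw [h2]
    refine lintegral_congr fun t => ?_
    rw [Real.enorm_of_nonneg (φ.nonneg_normed t)]
  have hφm : Measurable (φ.normed μ) := φ.continuous_normed.measurable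
  have hm : AEMeasurable (Function.uncurry fun x t => ‖φ.normed μ t • u (x - t)‖ₑ) (μ.prod μ) :=
    (AEStronglyMeasurable.convolution_integrand (lsmul ℝ ℝ) hφm.aestronglyMeasurable hu).enorm
  calc ∫⁻ x, ‖(φ.normed μ ⋆[lsmul ℝ ℝ, μ] u) x‖ₑ ∂μ
      ≤ ∫⁻ x, ∫⁻ t, ‖φ.normed μ t • u (x - t)‖ₑ ∂μ ∂μ :=
        lintegral_mono fun x => enorm_integral_le_lintegral_enorm _
    _ = ∫⁻ t, ∫⁻ x, ‖φ.normed μ t • u (x - t)‖ₑ ∂μ ∂μ := lintegral_lintegral_swap hm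
    _ = ∫⁻ t, ‖φ.normed μ t‖ₑ * ∫⁻ x, ‖u x‖ₑ ∂μ ∂μ := by
        refine lintegral_congr fun t => ?_
        simp only [enorm_smul]
        rw [lintegral_const_mul' _ _ enorm_ne_top, lintegral_sub_right_eq_self (fun x => ‖u x‖ₑ) t]
    _ = _ := by rw [lintegral_mul_const _ (by fun_prop), h1, one_mul]

variable [CompleteSpace E']

/-- Dominated convergence: once the mollifier has radius at most 1, the difference is bounded by 2C
and vanishes off the 1-neighbourhood of the support. -/
lemma tendsto_lintegral_enorm_normed_convolution_sub_of_continuous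
    {φ : ℕ → ContDiffBump (0 : E)} (hφ : Tendsto (fun j => (φ j).rOut) atTop (𝓝 0))
    {g : E → E'} (hg : Continuous g) (hc : HasCompactSupport g) :
    Tendsto (fun j => ∫⁻ x, ‖((φ j).normed μ ⋆[lsmul ℝ ℝ, μ] g) x - g x‖ₑ ∂μ) atTop (𝓝 0) := by
  obtain ⟨C, hC⟩ := hc.exists_bound_of_continuous hg
  have hconv : ∀ j, Continuous ((φ j).normed μ ⋆[lsmul ℝ ℝ, μ] g) := fun j =>
    (φ j).hasCompactSupport_normed.continuous_convolution_left _ (φ j).continuous_normed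
      hg.locallyIntegrable
  set K := cthickening 1 (tsupport g) with hK
  have hKm : MeasurableSet K := isClosed_cthickening.measurableSet
  have hKc : IsCompact K := hc.isCompact.cthickening
  rw [← lintegral_zero (α := E) (μ := μ)]
  refine tendsto_lintegral_filter_of_dominated_convergence
    (K.indicator fun _ => ENNReal.ofReal (2 * C)) ?_ ?_ ?_ ?_
  · exact Eventually.of_forall fun j => ((hconv j).sub hg).enorm.measurable
  · filter_upwards [hφ.eventually_le_const one_pos] with j hj
    refine Eventually.of_forall fun x => ?_
    by_cases hx : x ∈ K
    · rw [indicator_of_mem hx, ← ofReal_norm, ← dist_eq_norm]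
      refine ENNReal.ofReal_le_ofReal ?_
      refine (φ j).dist_normed_convolution_le hg.aestronglyMeasurable fun y _ => ?_
      rw [dist_eq_norm]
      refine (norm_sub_le _ _).trans ?_
      linarith [hC x, hC y]
    · rw [indicator_of_notMem hx, nonpos_iff_eq_zero, enorm_eq_zero, sub_eq_zero, ← dist_le_zero]
      have h0 : ∀ y ∈ closedBall x 1, g y = 0 := by
        intro y hy
        by_contra hne
        refine hx (mem_cthickening_of_dist_le x y 1 _ (subset_tsupport g hne) ?_)
        rw [dist_comm]; exact hy
      refine (φ j).dist_normed_convolution_le hg.aestronglyMeasurable fun y hy => ?_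
      rw [h0 y (closedBall_subset_closedBall hj (ball_subset_closedBall hy)),
        h0 x (mem_closedBall_self zero_le_one), dist_self]
  · rw [lintegral_indicator hKm, setLIntegral_const]
    exact ENNReal.mul_ne_top ENNReal.ofReal_ne_top hKc.measure_lt_top.ne
  · refine Eventually.of_forall fun x => ?_
    have h1 := ContDiffBump.convolution_tendsto_right_of_continuous (μ := μ) hφ hg x
    have h2 := (h1.sub_const (g x)).enorm
    simpa using h2

/-- Mollifications converge in `L¹`. -/
theorem tendsto_lintegral_enorm_normed_convolution_sub
    {φ : ℕ → ContDiffBump (0 : E)} (hφ : Tendsto (fun j => (φ j).rOut) atTop (𝓝 0))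
    {f : E → E'} (hf : Integrable f μ) :
    Tendsto (fun j => ∫⁻ x, ‖((φ j).normed μ ⋆[lsmul ℝ ℝ, μ] f) x - f x‖ₑ ∂μ) atTop (𝓝 0) := by
  rw [ENNReal.tendsto_nhds_zero]
  intro ε hε
  have hε3 : ε / 3 ≠ 0 := (ENNReal.div_pos hε.ne' ENNReal.ofNat_ne_top).ne'
  -- Density of compactly supported continuous functions, with the L¹ contraction property absorbing
  -- the mollified error.
  obtain ⟨g, hgc, hfg, hg, hgi⟩ := hf.exists_hasCompactSupport_lintegral_sub_le hε3
  filter_upwards [(ENNReal.tendsto_nhds_zero.1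
    (tendsto_lintegral_enorm_normed_convolution_sub_of_continuous μ hφ hg hgc)) (ε / 3)
      (pos_iff_ne_zero.2 hε3)] with j hj
  have hex : ∀ u : E → E', Integrable u μ → ∀ x,
      ConvolutionExistsAt ((φ j).normed μ) u x (lsmul ℝ ℝ) μ := fun u hu x =>
    (φ j).hasCompactSupport_normed.convolutionExists_left _ (φ j).continuous_normed
      hu.locallyIntegrable x
  have hconv : ∀ u : E → E', Integrable u μ → Continuous ((φ j).normed μ ⋆[lsmul ℝ ℝ, μ] u) :=
    fun u hu => (φ j).hasCompactSupport_normed.continuous_convolution_left _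
      (φ j).continuous_normed hu.locallyIntegrable
  have hsplit : ∀ x, ((φ j).normed μ ⋆[lsmul ℝ ℝ, μ] f) x =
      ((φ j).normed μ ⋆[lsmul ℝ ℝ, μ] (f - g)) x + ((φ j).normed μ ⋆[lsmul ℝ ℝ, μ] g) x := by
    intro x
    rw [← (hex _ (hf.sub hgi) x).distrib_add (hex g hgi x), sub_add_cancel]
  calc ∫⁻ x, ‖((φ j).normed μ ⋆[lsmul ℝ ℝ, μ] f) x - f x‖ₑ ∂μ
      ≤ ∫⁻ x, (‖((φ j).normed μ ⋆[lsmul ℝ ℝ, μ] (f - g)) x‖ₑ +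
        (‖((φ j).normed μ ⋆[lsmul ℝ ℝ, μ] g) x - g x‖ₑ + ‖f x - g x‖ₑ)) ∂μ := by
        refine lintegral_mono fun x => ?_
        have : ((φ j).normed μ ⋆[lsmul ℝ ℝ, μ] f) x - f x =
            ((φ j).normed μ ⋆[lsmul ℝ ℝ, μ] (f - g)) x +
            ((((φ j).normed μ ⋆[lsmul ℝ ℝ, μ] g) x - g x) - (f x - g x)) := by
          rw [hsplit]; abel
        rw [this]
        exact (enorm_add_le _ _).trans (by gcongr; exact enorm_sub_le)
    _ = ∫⁻ x, ‖((φ j).normed μ ⋆[lsmul ℝ ℝ, μ] (f - g)) x‖ₑ ∂μ +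
        (∫⁻ x, ‖((φ j).normed μ ⋆[lsmul ℝ ℝ, μ] g) x - g x‖ₑ ∂μ + ∫⁻ x, ‖f x - g x‖ₑ ∂μ) := by
        rw [lintegral_add_left (hconv _ (hf.sub hgi)).enorm.measurable,
          lintegral_add_left (f := fun x => ‖((φ j).normed μ ⋆[lsmul ℝ ℝ, μ] g) x - g x‖ₑ)
            ((hconv g hgi).sub hg).enorm.measurable]
    _ ≤ ε / 3 + (ε / 3 + ε / 3) := by
        gcongr
        exact (lintegral_enorm_normed_convolution_le μ (φ j)
          (hf.sub hgi).aestronglyMeasurable).trans hfg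
    _ = ε := by rw [← add_assoc, ENNReal.add_thirds]

end Mollifier

/-! ### Mollifying a weakly differentiable function. -/

section WeakMollifier

open ContinuousLinearMap (lsmul)
open scoped Convolution

variable {n : ℕ} {Ω : Set (EuclideanSpace ℝ (Fin n))}

/-- The derivative of a mollification is the mollification of the weak gradient. -/
lemma norm_fderiv_normed_convolution_le (hΩ : IsOpen Ω) {f : EuclideanSpace ℝ (Fin n) → ℝ}
    {g : EuclideanSpace ℝ (Fin n) → EuclideanSpace ℝ (Fin n)} (hfg : HasWeakGradient Ω f g)
    {K : Set (EuclideanSpace ℝ (Fin n))} (hK : IsCompact K) (hKΩ : K ⊆ Ω)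
    (φ : ContDiffBump (0 : EuclideanSpace ℝ (Fin n))) {x : EuclideanSpace ℝ (Fin n)}
    (hx : closedBall x φ.rOut ⊆ K) :
    ‖fderiv ℝ (φ.normed volume ⋆[lsmul ℝ ℝ, volume] K.indicator f) x‖ ≤
      ‖(φ.normed volume ⋆[lsmul ℝ ℝ, volume] K.indicator g) x‖ := by
  set η := φ.normed (volume : Measure (EuclideanSpace ℝ (Fin n))) with hη
  have hηc : HasCompactSupport η := φ.hasCompactSupport_normed
  have hηd : ContDiff ℝ ∞ η := φ.contDiff_normed
  have hηd1 : ContDiff ℝ 1 η := φ.contDiff_normed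
  have hfi : Integrable (K.indicator f) :=
    (hfg.locallyIntegrableOn.integrableOn_compact_subset hKΩ hK).integrable_indicator hK.measurableSet
  have hgi : Integrable (K.indicator g) :=
    (hfg.locallyIntegrableOn_grad.integrableOn_compact_subset hKΩ hK).integrable_indicator
      hK.measurableSet
  have hder := hηc.hasFDerivAt_convolution_left (L := lsmul ℝ ℝ) hηd1 hfi.locallyIntegrable x
  rw [hder.fderiv]
  set w := (η ⋆[lsmul ℝ ℝ, volume] K.indicator g) x with hw
  -- The reflected translate of the mollifier is supported in `K`, hence in Ω, and is the test
  -- function that transfers the derivative to `g`.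
  set ψ : EuclideanSpace ℝ (Fin n) → ℝ := fun t => η (x - t) with hψ
  have hψd : ContDiff ℝ ∞ ψ := hηd.comp (contDiff_const.sub contDiff_id)
  have hψ0 : ∀ t, t ∉ closedBall x φ.rOut → ψ t = 0 := by
    intro t ht
    have h1 : x - t ∉ Function.support η := by
      rw [hη, φ.support_normed_eq]
      intro h2
      apply ht
      rw [mem_ball_zero_iff] at h2
      rw [mem_closedBall, dist_comm, dist_eq_norm]
      exact h2.le
    simpa using h1
  have hψts : tsupport ψ ⊆ closedBall x φ.rOut :=
    closure_minimal (fun t ht => by by_contra h; exact ht (hψ0 t h)) isClosed_closedBall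
  have hψc : HasCompactSupport ψ := HasCompactSupport.of_support_subset_isCompact
    (isCompact_closedBall x φ.rOut) (subset_closure.trans hψts)
  have hfdψ : ∀ t v, fderiv ℝ ψ t v = - fderiv ℝ η (x - t) v := by
    intro t v
    have h1 : HasFDerivAt ψ _ t := ((hηd1.differentiable one_ne_zero) (x - t)).hasFDerivAt.comp t
      ((hasFDerivAt_const x t).sub (hasFDerivAt_id t))
    rw [h1.fderiv]
    simp
  have hmulK : ∀ (u a : EuclideanSpace ℝ (Fin n) → ℝ), (∀ t, t ∉ K → a t = 0) →
      ∫ t, a t * K.indicator u t = ∫ t in Ω, u t * a t := by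
    intro u a ha
    rw [← integral_indicator hΩ.measurableSet]
    refine integral_congr_ae (Eventually.of_forall fun t => ?_)
    by_cases ht : t ∈ K
    · simp only [indicator_of_mem ht, indicator_of_mem (hKΩ ht), mul_comm]
    · by_cases ht' : t ∈ Ω <;> simp [ht, ht', ha t ht]
  have hbasis : ∀ i : Fin n,
      (fderiv ℝ η ⋆[(lsmul ℝ ℝ).precompL (EuclideanSpace ℝ (Fin n)), volume] K.indicator f) x
        (EuclideanSpace.single i 1) = w i := by
    intro i
    have hwi : w i = ∫ t in Ω, g t i * ψ t := by
      have h1 : Integrable fun t => ψ t • K.indicator g t := by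
        obtain ⟨C, hC⟩ := hψc.exists_bound_of_continuous hψd.continuous
        exact hgi.bdd_smul C hψd.continuous.aestronglyMeasurable (Eventually.of_forall hC)
      have h2 : w = ∫ t, ψ t • K.indicator g t := by
        rw [hw, convolution_eq_swap]; rfl
      have h3 := (EuclideanSpace.proj (𝕜 := ℝ) i).integral_comp_comm h1
      rw [← h2] at h3
      rw [← hmulK (fun t => g t i) ψ fun t ht => hψ0 t fun h => ht (hx h)]
      refine h3.symm.trans (integral_congr_ae (Eventually.of_forall fun t => ?_))
      by_cases ht : t ∈ K <;> simp [ht]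
    have hint : Integrable fun t => ((lsmul ℝ ℝ).precompL (EuclideanSpace ℝ (Fin n)))
        (fderiv ℝ η (x - t)) (K.indicator f t) :=
      ((hηc.fderiv ℝ).convolutionExists_left _ (hηd1.continuous_fderiv one_ne_zero)
        hfi.locallyIntegrable x).integrable_swap
    have hD : (fderiv ℝ η ⋆[(lsmul ℝ ℝ).precompL (EuclideanSpace ℝ (Fin n)), volume]
        K.indicator f) x (EuclideanSpace.single i 1) =
        ∫ t, -fderiv ℝ ψ t (EuclideanSpace.single i 1) * K.indicator f t := by
      rw [convolution_eq_swap, ContinuousLinearMap.integral_apply hint]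
      refine integral_congr_ae (Eventually.of_forall fun t => ?_)
      simp [hfdψ, ContinuousLinearMap.precompL_apply]
    rw [hD, hwi]
    have h4 := hfg.integral_eq ψ hψd hψc (hψts.trans (hx.trans hKΩ)) i
    simp only [neg_mul]
    rw [integral_neg, hmulK, h4, neg_neg]
    intro t ht
    have h5 : fderiv ℝ ψ t = 0 := by
      by_contra hne
      exact ht (hx (hψts (support_fderiv_subset ℝ hne)))
    rw [h5]; rfl
  have hDw : (fderiv ℝ η ⋆[(lsmul ℝ ℝ).precompL (EuclideanSpace ℝ (Fin n)), volume]
      K.indicator f) x = innerSL ℝ w := by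
    refine ContinuousLinearMap.coe_injective
      ((EuclideanSpace.basisFun (Fin n) ℝ).toBasis.ext fun i => ?_)
    simp only [OrthonormalBasis.coe_toBasis, EuclideanSpace.basisFun_apply,
      ContinuousLinearMap.coe_coe, hbasis i, innerSL_apply_apply]
    rw [EuclideanSpace.inner_single_right]; simp
  rw [hDw, innerSL_apply_norm]

end WeakMollifier

/-! ### Weighted averages of a C¹ function along a path of balls. -/

section SmoothSegment

variable {E : Type*} [NormedAddCommGroup E] [NormedSpace ℝ E] [MeasurableSpace E] [BorelSpace E]
  [FiniteDimensional ℝ E] (μ : Measure E) [μ.IsAddHaarMeasure]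

/-- Averages over moving balls become integrals over the fixed unit ball, so differentiation along
the path falls on the integrand only. -/
lemma setLIntegral_unitBall_comp_affine (h : E → ℝ≥0∞) (c : E) {ρ : ℝ} (hρ : 0 < ρ) :
    ∫⁻ z in ball (0 : E) 1, h (c + ρ • z) ∂μ =
      ENNReal.ofReal (ρ ^ (-(finrank ℝ E : ℝ))) * ∫⁻ y in ball c ρ, h y ∂μ := by
  have hmem : ∀ z : E, z ∈ ball (0 : E) 1 ↔ c + ρ • z ∈ ball c ρ := by
    intro z
    rw [mem_ball_zero_iff, mem_ball, dist_eq_norm, add_sub_cancel_left, norm_smul,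
      Real.norm_of_nonneg hρ.le]
    exact (mul_lt_iff_lt_one_right hρ).symm
  set H := (ball c ρ).indicator h with hH
  have e1 : ∫⁻ z in ball (0 : E) 1, h (c + ρ • z) ∂μ = ∫⁻ z, H (c + ρ • z) ∂μ := by
    rw [← lintegral_indicator measurableSet_ball]
    refine lintegral_congr fun z => ?_
    by_cases hz : z ∈ ball (0 : E) 1
    · rw [indicator_of_mem hz, hH, indicator_of_mem ((hmem z).1 hz)]
    · rw [indicator_of_notMem hz, hH, indicator_of_notMem fun h => hz ((hmem z).2 h)]
  have e2 := lintegral_map_equiv (μ := μ) (fun y => H (c + y)) (MeasurableEquiv.smul₀ ρ hρ.ne')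
  have e3 : Measure.map (MeasurableEquiv.smul₀ ρ hρ.ne') μ =
      ENNReal.ofReal |(ρ ^ finrank ℝ E)⁻¹| • μ := Measure.map_addHaar_smul μ hρ.ne'
  rw [e3, lintegral_smul_measure, lintegral_add_left_eq_self H c, hH,
    lintegral_indicator measurableSet_ball, abs_of_pos (by positivity)] at e2
  rw [e1, Real.rpow_neg hρ.le, Real.rpow_natCast]
  exact e2.symm

/-- Comparison of weighted integrals of a `C¹` function over two balls, along the straight path of
balls joining them. -/
lemma setLIntegral_ball_le_of_contDiff {K : ℝ → ℝ} {C β : ℝ}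
    (hK : ContDiffOn ℝ 1 K (Ioi 0)) (hKβ : ∀ r, 0 < r → |K r| ≤ C * r ^ β)
    (hK'β : ∀ r, 0 < r → |deriv K r| ≤ C * r ^ (β - 1))
    {f : E → ℝ} (hf : ContDiff ℝ 1 f) {x y : E} {r m : ℝ} (hm0 : 0 ≤ m) (hm : m ≤ dist x y)
    (hmr : m < r) :
    ENNReal.ofReal (|K r| * r ^ (-(finrank ℝ E : ℝ))) * ∫⁻ z in ball x r, ‖f z‖ₑ ∂μ ≤
      ENNReal.ofReal (|K (r - m)| * (r - m) ^ (-(finrank ℝ E : ℝ))) *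
          ∫⁻ z in ball y (r - m), ‖f z‖ₑ ∂μ +
        ENNReal.ofReal (C * dist x y) * ∫⁻ t in Icc (0 : ℝ) 1,
          (ENNReal.ofReal ((r - t * m) ^ (β - 1 - finrank ℝ E)) *
              ∫⁻ z in ball (x + t • (y - x)) (r - t * m), ‖f z‖ₑ ∂μ +
            2 * (ENNReal.ofReal ((r - t * m) ^ (β - finrank ℝ E)) *
              ∫⁻ z in ball (x + t • (y - x)) (r - t * m), ‖fderiv ℝ f z‖ₑ ∂μ)) := by
  set d : ℝ := ((finrank ℝ E : ℕ) : ℝ) with hd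
  set δ := dist x y with hδ
  have hδn : ‖y - x‖ = δ := by rw [hδ, dist_comm, dist_eq_norm]
  have hδ0 : 0 ≤ δ := dist_nonneg
  have hr : 0 < r := hm0.trans_lt hmr
  have hC : 0 ≤ C := by
    have h1 := (abs_nonneg _).trans (hKβ 1 one_pos)
    simpa using h1
  have hρ : ∀ t ∈ Icc (0 : ℝ) 1, 0 < r - t * m := by
    intro t ht
    nlinarith [ht.1, ht.2]
  let pt : ℝ → E → E := fun t z => (x + t • (y - x)) + (r - t * m) • z
  let B : ℝ → E → ℝ≥0∞ := fun t z =>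
    ENNReal.ofReal (C * δ) * (ENNReal.ofReal ((r - t * m) ^ (β - 1)) * ‖f (pt t z)‖ₑ +
      2 * (ENNReal.ofReal ((r - t * m) ^ β) * ‖fderiv ℝ f (pt t z)‖ₑ))
  have hfm : Continuous fun z => ‖f z‖ₑ := hf.continuous.enorm
  have hf'm : Continuous fun z => ‖fderiv ℝ f z‖ₑ := (hf.continuous_fderiv one_ne_zero).enorm
  have hptc : Continuous (Function.uncurry pt) := by
    simp only [pt, Function.uncurry_def]; fun_prop
  have hBm : Measurable (Function.uncurry B) := by
    have h1 : Measurable fun q : ℝ × E => ‖f (pt q.1 q.2)‖ₑ := (hfm.comp hptc).measurable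
    have h2 : Measurable fun q : ℝ × E => ‖fderiv ℝ f (pt q.1 q.2)‖ₑ :=
      (hf'm.comp hptc).measurable
    simp only [B, Function.uncurry_def]
    fun_prop
  have hpoint : ∀ z ∈ ball (0 : E) 1, ENNReal.ofReal |K r| * ‖f (x + r • z)‖ₑ ≤
      ENNReal.ofReal |K (r - m)| * ‖f (y + (r - m) • z)‖ₑ + ∫⁻ t in Icc (0 : ℝ) 1, B t z := by
    intro z hz
    rw [mem_ball_zero_iff] at hz
    -- Follow one point `z` of the unit ball along the path. The derivative of `K` gives the term in
    -- |f|, with m ≤ δ; the derivative of `f` gives the gradient term, its velocity (y-x) - mz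
    -- having norm at most 2δ.
    let ψ : ℝ → ℝ := fun t => K (r - t * m) * f (pt t z)
    have hptd : ∀ t, HasDerivAt (fun t => pt t z) ((y - x) - m • z) t := by
      intro t
      have h1 : HasDerivAt (fun t : ℝ => x + t • (y - x)) ((1 : ℝ) • (y - x)) t :=
        ((hasDerivAt_id t).smul_const (y - x)).const_add x
      have h2 : HasDerivAt (fun t : ℝ => (r - t * m) • z) ((-(1 * m)) • z) t :=
        (((hasDerivAt_id t).mul_const m).const_sub r).smul_const z
      have h3 := h1.add h2
      rw [show (1 : ℝ) • (y - x) + (-(1 * m)) • z = (y - x) - m • z by module] at h3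
      exact h3
    have hψd : ∀ t ∈ Icc (0 : ℝ) 1, HasDerivAt ψ (deriv K (r - t * m) * (-(1 * m)) * f (pt t z) +
        K (r - t * m) * fderiv ℝ f (pt t z) ((y - x) - m • z)) t := by
      intro t ht
      have hKd : HasDerivAt K (deriv K (r - t * m)) (r - t * m) :=
        ((hK.differentiableOn one_ne_zero).differentiableAt
          (Ioi_mem_nhds (hρ t ht))).hasDerivAt
      have h1 : HasDerivAt (fun t => K (r - t * m)) (deriv K (r - t * m) * (-(1 * m))) t :=
        hKd.comp t (((hasDerivAt_id t).mul_const m).const_sub r)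
      have h2 : HasDerivAt (fun t => f (pt t z)) (fderiv ℝ f (pt t z) ((y - x) - m • z)) t :=
        ((hf.differentiable one_ne_zero) (pt t z)).hasFDerivAt.comp_hasDerivAt t (hptd t)
      exact h1.mul h2
    have hψc : ContDiffOn ℝ 1 ψ (Icc 0 1) := by
      refine ContDiffOn.mul (hK.comp (by fun_prop) fun t ht => hρ t ht) ?_
      refine (hf.comp ?_).contDiffOn
      simp only [pt]; fun_prop
    have hmain := enorm_sub_le_lintegral_deriv_of_contDiffOn_Icc hψc zero_le_one
    have hder : ∫⁻ t in Icc (0 : ℝ) 1, ‖deriv ψ t‖ₑ ≤ ∫⁻ t in Icc (0 : ℝ) 1, B t z := by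
      refine setLIntegral_mono' measurableSet_Icc fun t ht => ?_
      have hρt := hρ t ht
      rw [(hψd t ht).deriv]
      have hv : ‖(y - x) - m • z‖ ≤ 2 * δ := by
        refine (norm_sub_le _ _).trans ?_
        rw [hδn, norm_smul, Real.norm_of_nonneg hm0]
        nlinarith [norm_nonneg z]
      have hreal : ‖deriv K (r - t * m) * (-(1 * m)) * f (pt t z) +
          K (r - t * m) * fderiv ℝ f (pt t z) ((y - x) - m • z)‖ ≤
          C * δ * ((r - t * m) ^ (β - 1) * ‖f (pt t z)‖ +
            2 * ((r - t * m) ^ β * ‖fderiv ℝ f (pt t z)‖)) := by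
        have t1 : ‖deriv K (r - t * m) * (-(1 * m)) * f (pt t z)‖ ≤
            C * (r - t * m) ^ (β - 1) * δ * ‖f (pt t z)‖ := by
          rw [norm_mul, norm_mul, norm_neg, one_mul, Real.norm_of_nonneg hm0, Real.norm_eq_abs]
          gcongr
          exact hK'β _ hρt
        have t2 : ‖K (r - t * m) * fderiv ℝ f (pt t z) ((y - x) - m • z)‖ ≤
            C * (r - t * m) ^ β * (‖fderiv ℝ f (pt t z)‖ * (2 * δ)) := by
          rw [norm_mul, Real.norm_eq_abs (K _)]
          gcongr
          · exact hKβ _ hρt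
          · exact (ContinuousLinearMap.le_opNorm _ _).trans (by gcongr)
        refine (norm_add_le _ _).trans ((add_le_add t1 t2).trans_eq ?_)
        ring
      rw [← ofReal_norm]
      refine (ENNReal.ofReal_le_ofReal hreal).trans_eq ?_
      have p1 : 0 ≤ (r - t * m) ^ (β - 1) := by positivity
      have p2 : 0 ≤ (r - t * m) ^ β := by positivity
      rw [ENNReal.ofReal_mul (mul_nonneg hC hδ0),
        ENNReal.ofReal_add (by positivity) (by positivity),
        ENNReal.ofReal_mul p1, ENNReal.ofReal_mul zero_le_two,
        ENNReal.ofReal_mul p2, ofReal_norm, ofReal_norm, ENNReal.ofReal_ofNat]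
    have e0 : ‖ψ 0‖ₑ = ENNReal.ofReal |K r| * ‖f (x + r • z)‖ₑ := by
      simp only [ψ, pt, enorm_mul, zero_mul, zero_smul, sub_zero, add_zero]
      rw [← ofReal_norm (K r), Real.norm_eq_abs]
    have e1 : ‖ψ 1‖ₑ = ENNReal.ofReal |K (r - m)| * ‖f (y + (r - m) • z)‖ₑ := by
      simp only [ψ, pt, enorm_mul, one_mul, one_smul, add_sub_cancel]
      rw [← ofReal_norm (K _), Real.norm_eq_abs]
    rw [← e0, ← e1]
    calc ‖ψ 0‖ₑ = ‖ψ 1 - (ψ 1 - ψ 0)‖ₑ := by rw [sub_sub_cancel]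
      _ ≤ ‖ψ 1‖ₑ + ‖ψ 1 - ψ 0‖ₑ := enorm_sub_le
      _ ≤ _ := by gcongr; exact hmain.trans hder
  have hpc : ∀ t, Continuous (pt t) := fun t => by simp only [pt]; fun_prop
  have hL : ∀ c : E, ∀ s : ℝ, 0 < s → ENNReal.ofReal (|K s| * s ^ (-d)) *
      ∫⁻ z in ball c s, ‖f z‖ₑ ∂μ =
      ∫⁻ z in ball (0 : E) 1, ENNReal.ofReal |K s| * ‖f (c + s • z)‖ₑ ∂μ := by
    intro c s hs
    rw [lintegral_const_mul' _ _ ENNReal.ofReal_ne_top,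
      setLIntegral_unitBall_comp_affine μ (fun z => ‖f z‖ₑ) c hs,
      ENNReal.ofReal_mul (abs_nonneg _), mul_assoc]
  rw [hL x r hr, hL y (r - m) (by linarith)]
  have hR : ENNReal.ofReal (C * δ) * ∫⁻ t in Icc (0 : ℝ) 1,
          (ENNReal.ofReal ((r - t * m) ^ (β - 1 - d)) *
              ∫⁻ z in ball (x + t • (y - x)) (r - t * m), ‖f z‖ₑ ∂μ +
            2 * (ENNReal.ofReal ((r - t * m) ^ (β - d)) *
              ∫⁻ z in ball (x + t • (y - x)) (r - t * m), ‖fderiv ℝ f z‖ₑ ∂μ)) =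
      ∫⁻ t in Icc (0 : ℝ) 1, (∫⁻ z in ball (0 : E) 1, B t z ∂μ) := by
    rw [← lintegral_const_mul' _ _ ENNReal.ofReal_ne_top]
    refine setLIntegral_congr_fun measurableSet_Icc fun t ht => ?_
    have hρt := hρ t ht
    have m1 : Measurable fun z => ‖f (pt t z)‖ₑ := (hfm.comp (hpc t)).measurable
    have m2 : Measurable fun z => ‖fderiv ℝ f (pt t z)‖ₑ := (hf'm.comp (hpc t)).measurable
    have p1 : 0 ≤ (r - t * m) ^ (β - 1) := by positivity
    have p2 : 0 ≤ (r - t * m) ^ β := by positivity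
    have a1 : ∀ a : ℝ, (r - t * m) ^ (a - d) = (r - t * m) ^ a * (r - t * m) ^ (-d) := by
      intro a; rw [← Real.rpow_add hρt, sub_eq_add_neg a d]
    simp only [B]
    rw [lintegral_const_mul _ (by fun_prop), lintegral_add_left (by fun_prop),
      lintegral_const_mul _ m1, lintegral_const_mul _ (by fun_prop), lintegral_const_mul _ m2,
      setLIntegral_unitBall_comp_affine μ (fun z => ‖f z‖ₑ) _ hρt,
      setLIntegral_unitBall_comp_affine μ (fun z => ‖fderiv ℝ f z‖ₑ) _ hρt, a1, a1,
      ENNReal.ofReal_mul p1, ENNReal.ofReal_mul p2]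
    simp only [mul_assoc, hd]
  rw [hR]
  calc _ ≤ ∫⁻ z in ball (0 : E) 1, (ENNReal.ofReal |K (r - m)| * ‖f (y + (r - m) • z)‖ₑ +
        ∫⁻ t in Icc (0 : ℝ) 1, B t z) ∂μ := setLIntegral_mono' measurableSet_ball hpoint
    _ = ∫⁻ z in ball (0 : E) 1, ENNReal.ofReal |K (r - m)| * ‖f (y + (r - m) • z)‖ₑ ∂μ +
        ∫⁻ z in ball (0 : E) 1, (∫⁻ t in Icc (0 : ℝ) 1, B t z) ∂μ := by
      refine lintegral_add_left ?_ _
      have : Measurable fun z => ‖f (y + (r - m) • z)‖ₑ :=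
        (hfm.comp (by fun_prop : Continuous fun z : E => y + (r - m) • z)).measurable
      fun_prop
    _ = _ := by
      congr 1
      refine (lintegral_lintegral_swap ?_).symm
      exact hBm.aemeasurable

end SmoothSegment

/-! ### The same comparison for weakly differentiable functions. -/

section WeakSegment

open ContinuousLinearMap (lsmul)
open scoped Convolution

variable {n : ℕ} {Ω : Set (EuclideanSpace ℝ (Fin n))} {f : EuclideanSpace ℝ (Fin n) → ℝ}
  {g : EuclideanSpace ℝ (Fin n) → EuclideanSpace ℝ (Fin n)}

/-- On a ball compactly contained in `Ω`, a weakly differentiable function and its weak gradient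
are approximated in `L¹` by smooth functions and bounds for their derivatives. -/
lemma HasWeakGradient.exists_smooth_approx (hΩ : IsOpen Ω) (hfg : HasWeakGradient Ω f g)
    {x : EuclideanSpace ℝ (Fin n)} {D : ℝ} (hD : closedBall x D ⊆ Ω) :
    ∃ (F : ℕ → EuclideanSpace ℝ (Fin n) → ℝ)
      (W : ℕ → EuclideanSpace ℝ (Fin n) → EuclideanSpace ℝ (Fin n)),
      (∀ j, ContDiff ℝ 1 (F j)) ∧
      (∀ᶠ j in atTop, ∀ y ∈ ball x D, ‖fderiv ℝ (F j) y‖ₑ ≤ ‖W j y‖ₑ) ∧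
      Tendsto (fun j => ∫⁻ y in ball x D, ‖F j y - f y‖ₑ) atTop (𝓝 0) ∧
      Tendsto (fun j => ∫⁻ y in ball x D, ‖W j y - g y‖ₑ) atTop (𝓝 0) := by
  obtain ⟨δ, hδ, hδΩ⟩ := (isCompact_closedBall x D).exists_cthickening_subset_open hΩ hD
  set K := cthickening δ (closedBall x D) with hK
  have hKc : IsCompact K := (isCompact_closedBall x D).cthickening
  have hKm : MeasurableSet K := hKc.measurableSet
  have hsub : ball x D ⊆ K := ball_subset_closedBall.trans (self_subset_cthickening _)
  have hfi : Integrable (K.indicator f) :=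
    (hfg.locallyIntegrableOn.integrableOn_compact_subset hδΩ hKc).integrable_indicator hKm
  have hgi : Integrable (K.indicator g) :=
    (hfg.locallyIntegrableOn_grad.integrableOn_compact_subset hδΩ hKc).integrable_indicator hKm
  let φ : ℕ → ContDiffBump (0 : EuclideanSpace ℝ (Fin n)) := fun j =>
    ⟨1 / (j + 1) / 2, 1 / (j + 1), half_pos Nat.one_div_pos_of_nat,
      half_lt_self Nat.one_div_pos_of_nat⟩
  have hφ : Tendsto (fun j => (φ j).rOut) atTop (𝓝 0) := tendsto_one_div_add_atTop_nhds_zero_nat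
  have hle : ∀ {G : Type} [NormedAddCommGroup G] (u v : EuclideanSpace ℝ (Fin n) → G),
      ∫⁻ y in ball x D, ‖u y - v y‖ₑ ≤ ∫⁻ y, ‖u y - K.indicator v y‖ₑ := by
    intro G _ u v
    refine le_trans (le_of_eq ?_) (setLIntegral_le_lintegral (ball x D) _)
    refine setLIntegral_congr_fun measurableSet_ball fun y hy => ?_
    simp only [indicator_of_mem (hsub hy)]
  -- `W` is the mollified weak gradient. It dominates the derivative once the mollification radius
  -- is at most `δ`, because then only values on `K` enter.
  refine ⟨fun j => (φ j).normed volume ⋆[lsmul ℝ ℝ, volume] K.indicator f,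
    fun j => (φ j).normed volume ⋆[lsmul ℝ ℝ, volume] K.indicator g, fun j => ?_, ?_, ?_, ?_⟩
  · exact (φ j).hasCompactSupport_normed.contDiff_convolution_left (n := 1) _
      (φ j).contDiff_normed hfi.locallyIntegrable
  · filter_upwards [hφ.eventually_le_const hδ] with j hj y hy
    rw [enorm_le_iff_norm_le]
    refine norm_fderiv_normed_convolution_le hΩ hfg hKc hδΩ (φ j) fun z hz => ?_
    exact mem_cthickening_of_dist_le z y δ _ (ball_subset_closedBall hy) (hz.trans hj)
  · exact tendsto_of_tendsto_of_tendsto_of_le_of_le tendsto_const_nhds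
      (tendsto_lintegral_enorm_normed_convolution_sub volume hφ hfi) (fun _ => zero_le)
      fun j => hle _ f
  · exact tendsto_of_tendsto_of_tendsto_of_le_of_le tendsto_const_nhds
      (tendsto_lintegral_enorm_normed_convolution_sub volume hφ hgi) (fun _ => zero_le)
      fun j => hle _ g

/-- A power is monotone in its base, in a direction set by the sign of the exponent; adding both
endpoint values avoids knowing that sign. -/
lemma rpow_le_rpow_add_rpow {a s b : ℝ} (ha : 0 < a) (has : a ≤ s) (hsb : s ≤ b) (e : ℝ) :
    s ^ e ≤ a ^ e + b ^ e := by
  have hs : 0 < s := ha.trans_le has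
  have hb : 0 < b := hs.trans_le hsb
  rcases le_total 0 e with he | he
  · exact (Real.rpow_le_rpow hs.le hsb he).trans (le_add_of_nonneg_left (by positivity))
  · exact (Real.rpow_le_rpow_of_nonpos ha has he).trans (le_add_of_nonneg_right (by positivity))

lemma setLIntegral_enorm_le_add {X G : Type*} [MeasurableSpace X] {μ : Measure X}
    [NormedAddCommGroup G] {A B : Set X} (hAB : A ⊆ B) {u v : X → G}
    (hv : AEStronglyMeasurable v (μ.restrict A)) :
    ∫⁻ y in A, ‖u y‖ₑ ∂μ ≤ ∫⁻ y in A, ‖v y‖ₑ ∂μ + ∫⁻ y in B, ‖u y - v y‖ₑ ∂μ := by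
  calc ∫⁻ y in A, ‖u y‖ₑ ∂μ ≤ ∫⁻ y in A, (‖v y‖ₑ + ‖u y - v y‖ₑ) ∂μ := by
        refine lintegral_mono fun y => ?_
        calc ‖u y‖ₑ = ‖v y + (u y - v y)‖ₑ := by rw [add_sub_cancel]
          _ ≤ _ := enorm_add_le _ _
    _ = ∫⁻ y in A, ‖v y‖ₑ ∂μ + ∫⁻ y in A, ‖u y - v y‖ₑ ∂μ := lintegral_add_left' hv.enorm _
    _ ≤ _ := by gcongr

/-- From mD = rδ, the gap times D factors as (D-r)(D-tδ) ≥ 0. This choice of `m` keeps the moving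
balls inside B(x,D) while leaving their radii positive, even when r < δ. -/
lemma segment_radius_le {r δ D t m : ℝ} (hr : 0 < r) (hrD : r < D) (hδ : 0 ≤ δ) (hδD : δ < D)
    (hm : m = r * δ / D) (ht : t ∈ Icc (0 : ℝ) 1) : r - t * m + t * δ ≤ D := by
  have hD0 : 0 < D := hr.trans hrD
  have hmD : m * D = r * δ := by rw [hm]; field_simp
  have h1 : t * δ ≤ D := by nlinarith [ht.1, ht.2]
  have h2 : D * (r - t * m + t * δ) ≤ D * D := by
    have : D * (r - t * m + t * δ) = D * D - (D - r) * (D - t * δ) := by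
      linear_combination (-t) * hmD
    rw [this]
    nlinarith
  exact le_of_mul_le_mul_left h2 hD0

lemma ball_segment_subset {x y : EuclideanSpace ℝ (Fin n)} {r D t m : ℝ} (hr : 0 < r)
    (hrD : r < D) (hyD : dist x y < D) (hm : m = r * dist x y / D) (ht : t ∈ Icc (0 : ℝ) 1) :
    ball (x + t • (y - x)) (r - t * m) ⊆ ball x D := by
  refine ball_subset_ball' ?_
  rw [dist_eq_norm, add_sub_cancel_left, norm_smul, Real.norm_of_nonneg ht.1, ← dist_eq_norm,
    dist_comm]
  exact segment_radius_le hr hrD dist_nonneg hyD hm ht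

/-- Comparison of weighted integrals of a weakly differentiable function over two balls. -/
lemma HasWeakGradient.setLIntegral_ball_le (hΩ : IsOpen Ω) (hfg : HasWeakGradient Ω f g)
    {K : ℝ → ℝ} {C β : ℝ} (hK : ContDiffOn ℝ 1 K (Ioi 0)) (hKβ : ∀ r, 0 < r → |K r| ≤ C * r ^ β)
    (hK'β : ∀ r, 0 < r → |deriv K r| ≤ C * r ^ (β - 1))
    {x y : EuclideanSpace ℝ (Fin n)} {r D m : ℝ} (hr : 0 < r) (hrD : r < D) (hyD : dist x y < D)
    (hD : closedBall x D ⊆ Ω) (hm : m = r * dist x y / D) :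
    ENNReal.ofReal (|K r| * r ^ (-(n : ℝ))) * ∫⁻ z in ball x r, ‖f z‖ₑ ≤
      ENNReal.ofReal (|K (r - m)| * (r - m) ^ (-(n : ℝ))) * (∫⁻ z in ball y (r - m), ‖f z‖ₑ) +
        ENNReal.ofReal (C * dist x y) * ∫⁻ t in Icc (0 : ℝ) 1,
          (ENNReal.ofReal ((r - t * m) ^ (β - 1 - n)) *
              (∫⁻ z in ball (x + t • (y - x)) (r - t * m), ‖f z‖ₑ) +
            2 * (ENNReal.ofReal ((r - t * m) ^ (β - n)) *
              ∫⁻ z in ball (x + t • (y - x)) (r - t * m), ‖g z‖ₑ)) := by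
  have hD0 : 0 < D := hr.trans hrD
  set δ := dist x y with hδ
  have hδ0 : 0 ≤ δ := dist_nonneg
  have hm0 : 0 ≤ m := by rw [hm]; positivity
  have hmδ : m ≤ δ := by
    rw [hm, div_le_iff₀ hD0]; nlinarith
  have hmr : m < r := by
    rw [hm, div_lt_iff₀ hD0]; nlinarith
  have hball : ∀ t ∈ Icc (0 : ℝ) 1, ball (x + t • (y - x)) (r - t * m) ⊆ ball x D :=
    fun t ht => ball_segment_subset hr hrD hyD hm ht
  have hballx : ball x r ⊆ ball x D := ball_subset_ball hrD.le
  have hbally : ball y (r - m) ⊆ ball x D := by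
    have := hball 1 ⟨zero_le_one, le_rfl⟩
    rwa [one_smul, add_sub_cancel, one_mul] at this
  have hfm : AEStronglyMeasurable f (volume.restrict (ball x D)) :=
    ((hfg.locallyIntegrableOn.integrableOn_compact_subset hD (isCompact_closedBall x D)).mono_set
      ball_subset_closedBall).aestronglyMeasurable
  have hgm : AEStronglyMeasurable g (volume.restrict (ball x D)) :=
    ((hfg.locallyIntegrableOn_grad.integrableOn_compact_subset hD
      (isCompact_closedBall x D)).mono_set ball_subset_closedBall).aestronglyMeasurable
  obtain ⟨F, W, hF, hW, hFf, hWg⟩ := hfg.exists_smooth_approx hΩ hD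
  set e : ℕ → ℝ≥0∞ := fun j => ∫⁻ y in ball x D, ‖F j y - f y‖ₑ with he
  set e' : ℕ → ℝ≥0∞ := fun j => ∫⁻ y in ball x D, ‖W j y - g y‖ₑ with he'
  set M : ℝ≥0∞ := ENNReal.ofReal ((r - m) ^ (β - 1 - n) + r ^ (β - 1 - n)) +
    ENNReal.ofReal ((r - m) ^ (β - n) + r ^ (β - n)) with hM
  have hMtop : M ≠ ⊤ := by finiteness
  set A₀ := ENNReal.ofReal (|K r| * r ^ (-(n : ℝ))) with hA₀
  set A₁ := ENNReal.ofReal (|K (r - m)| * (r - m) ^ (-(n : ℝ))) with hA₁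
  set L := ENNReal.ofReal (C * δ) with hL
  set I : ℝ → ℝ≥0∞ := fun t => ENNReal.ofReal ((r - t * m) ^ (β - 1 - n)) *
              (∫⁻ z in ball (x + t • (y - x)) (r - t * m), ‖f z‖ₑ) +
            2 * (ENNReal.ofReal ((r - t * m) ^ (β - n)) *
              ∫⁻ z in ball (x + t • (y - x)) (r - t * m), ‖g z‖ₑ) with hI
  set R := A₁ * (∫⁻ z in ball y (r - m), ‖f z‖ₑ) + L * ∫⁻ t in Icc (0 : ℝ) 1, I t with hR
  -- Replacing the smooth approximants by `f` and `g` costs multiples of the L¹ errors `e j` and `e'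
  -- j`. The factors are finite and independent of `j`, since `M` bounds the powers of the radius
  -- for all t in [0,1].
  have hbound : ∀ᶠ j in atTop, A₀ * ∫⁻ z in ball x r, ‖f z‖ₑ ≤
      R + ((A₀ + A₁ + L * M) * e j + L * (2 * M) * e' j) := by
    filter_upwards [hW] with j hj
    have hFm : Continuous (F j) := (hF j).continuous
    have s0 : ∫⁻ z in ball x r, ‖f z‖ₑ ≤ (∫⁻ z in ball x r, ‖F j z‖ₑ) + e j := by
      refine (setLIntegral_enorm_le_add hballx (v := F j) hFm.aestronglyMeasurable).trans_eq ?_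
      simp only [he, enorm_sub_rev (f _)]
    have s1 : ∀ A ⊆ ball x D, ∫⁻ z in A, ‖F j z‖ₑ ≤ (∫⁻ z in A, ‖f z‖ₑ) + e j := fun A hA =>
      setLIntegral_enorm_le_add hA (hfm.mono_measure (Measure.restrict_mono hA le_rfl))
    have s2 : ∀ A ⊆ ball x D, MeasurableSet A →
        ∫⁻ z in A, ‖fderiv ℝ (F j) z‖ₑ ≤ (∫⁻ z in A, ‖g z‖ₑ) + e' j := fun A hA hAm =>
      (setLIntegral_mono' hAm fun z hz => hj z (hA hz)).trans
        (setLIntegral_enorm_le_add hA (hgm.mono_measure (Measure.restrict_mono hA le_rfl)))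
    have hS := setLIntegral_ball_le_of_contDiff volume hK hKβ hK'β (hF j) (x := x) (y := y)
      hm0 hmδ hmr
    rw [finrank_euclideanSpace_fin] at hS
    have hint : ∀ t ∈ Icc (0 : ℝ) 1, ENNReal.ofReal ((r - t * m) ^ (β - 1 - n)) *
              (∫⁻ z in ball (x + t • (y - x)) (r - t * m), ‖F j z‖ₑ) +
            2 * (ENNReal.ofReal ((r - t * m) ^ (β - n)) *
              ∫⁻ z in ball (x + t • (y - x)) (r - t * m), ‖fderiv ℝ (F j) z‖ₑ) ≤
        I t + (M * e j + 2 * (M * e' j)) := by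
      intro t ht
      have b1 : r - m ≤ r - t * m := by nlinarith [ht.2]
      have b2 : r - t * m ≤ r := by nlinarith [ht.1]
      have b0 : 0 < r - m := by linarith
      have M1 : ENNReal.ofReal ((r - t * m) ^ (β - 1 - n)) ≤ M :=
        (ENNReal.ofReal_le_ofReal (rpow_le_rpow_add_rpow b0 b1 b2 _)).trans le_self_add
      have M2 : ENNReal.ofReal ((r - t * m) ^ (β - n)) ≤ M :=
        (ENNReal.ofReal_le_ofReal (rpow_le_rpow_add_rpow b0 b1 b2 _)).trans le_add_self
      calc _ ≤ ENNReal.ofReal ((r - t * m) ^ (β - 1 - n)) *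
              ((∫⁻ z in ball (x + t • (y - x)) (r - t * m), ‖f z‖ₑ) + e j) +
            2 * (ENNReal.ofReal ((r - t * m) ^ (β - n)) *
              ((∫⁻ z in ball (x + t • (y - x)) (r - t * m), ‖g z‖ₑ) + e' j)) := by
            gcongr
            · exact s1 _ (hball t ht)
            · exact s2 _ (hball t ht) measurableSet_ball
        _ = I t + (ENNReal.ofReal ((r - t * m) ^ (β - 1 - n)) * e j +
            2 * (ENNReal.ofReal ((r - t * m) ^ (β - n)) * e' j)) := by
            simp only [hI]; ring
        _ ≤ _ := by gcongr
    calc A₀ * ∫⁻ z in ball x r, ‖f z‖ₑ ≤ A₀ * ((∫⁻ z in ball x r, ‖F j z‖ₑ) + e j) := by gcongr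
      _ = A₀ * (∫⁻ z in ball x r, ‖F j z‖ₑ) + A₀ * e j := mul_add _ _ _
      _ ≤ (A₁ * ((∫⁻ z in ball y (r - m), ‖f z‖ₑ) + e j) +
          L * ∫⁻ t in Icc (0 : ℝ) 1, (I t + (M * e j + 2 * (M * e' j)))) + A₀ * e j := by
        refine add_le_add_left (hS.trans (add_le_add ?_ ?_)) _
        · exact mul_le_mul_right (s1 _ hbally) _
        · exact mul_le_mul_right (setLIntegral_mono' measurableSet_Icc hint) _
      _ = _ := by
        rw [lintegral_add_right _ measurable_const, setLIntegral_const, Real.volume_Icc]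
        simp only [sub_zero, ENNReal.ofReal_one, mul_one, hR]
        ring
  have hlim : Tendsto (fun j => R + ((A₀ + A₁ + L * M) * e j + L * (2 * M) * e' j)) atTop
      (𝓝 (R + ((A₀ + A₁ + L * M) * 0 + L * (2 * M) * 0))) := by
    refine tendsto_const_nhds.add (Tendsto.add ?_ ?_)
    · exact ENNReal.Tendsto.const_mul hFf (Or.inr (by finiteness))
    · exact ENNReal.Tendsto.const_mul hWg (Or.inr (by finiteness))
  simp only [mul_zero, add_zero] at hlim
  exact ge_of_tendsto hlim hbound

end WeakSegment

/-! ### Bounds for the radial kernel. -/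

section Kernel

/-- The radial weight of the maximal function `maximalFn`, up to the factor `r⁻ⁿ`, where `κ` is the
volume of the unit ball. -/
noncomputable def radialWeight (n : ℕ) (κ β a γ r : ℝ) : ℝ :=
  r ^ β * (1 + r ^ n) ^ a * (1 + κ * r ^ n) ^ (-γ) * κ⁻¹

variable {n : ℕ} {κ β a γ : ℝ}

/-- Logarithmic form of the derivative: both fractions lie in [0,1], so the derivative is at most a
constant times the weight over `r`. -/
lemma hasDerivAt_radialWeight (hκ : 0 < κ) {r : ℝ} (hr : 0 < r) :
    HasDerivAt (radialWeight n κ β a γ)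
      (radialWeight n κ β a γ r *
        (β + n * a * (r ^ n / (1 + r ^ n)) - n * γ * (κ * r ^ n / (1 + κ * r ^ n))) / r) r := by
  have h1 : 0 < 1 + r ^ n := by positivity
  have h2 : 0 < 1 + κ * r ^ n := by positivity
  have d1 : HasDerivAt (fun r : ℝ => r ^ β) (β * r ^ (β - 1)) r :=
    Real.hasDerivAt_rpow_const (Or.inl hr.ne')
  have d2 := ((hasDerivAt_pow n r).const_add 1).rpow_const (p := a) (Or.inl h1.ne')
  have d3 := (((hasDerivAt_pow n r).const_mul κ).const_add 1).rpow_const (p := -γ)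
    (Or.inl h2.ne')
  have d4 := ((d1.mul d2).mul d3).mul_const κ⁻¹
  refine d4.congr_deriv ?_
  have hn : (n : ℝ) * r ^ (n - 1) = n * r ^ n / r := by
    rcases n with _ | k
    · simp
    · rw [Nat.add_sub_cancel, pow_succ]; field_simp
  simp only [radialWeight, Pi.mul_apply]
  rw [hn, Real.rpow_sub_one hr.ne', Real.rpow_sub_one h1.ne', Real.rpow_sub_one h2.ne']
  field_simp
  ring

lemma contDiffOn_radialWeight (hκ : 0 < κ) : ContDiffOn ℝ 1 (radialWeight n κ β a γ) (Ioi 0) := by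
  unfold radialWeight
  refine ContDiffOn.mul (ContDiffOn.mul (ContDiffOn.mul ?_ ?_) ?_) contDiffOn_const
  · exact contDiffOn_id.rpow_const_of_ne fun r hr => (mem_Ioi.1 hr).ne'
  · refine ContDiffOn.rpow_const_of_ne (by fun_prop) fun r hr => ?_
    have := mem_Ioi.1 hr
    positivity
  · refine ContDiffOn.rpow_const_of_ne (by fun_prop) fun r hr => ?_
    have := mem_Ioi.1 hr
    positivity

lemma radialWeight_nonneg (hκ : 0 < κ) {r : ℝ} (hr : 0 < r) : 0 ≤ radialWeight n κ β a γ r := by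
  unfold radialWeight
  positivity

/-- With c = max(1, 1/κ) one has 1 + rⁿ ≤ c(1 + κrⁿ), so a ≤ γ lets the negative power absorb the
positive one. The bound on the derivative then follows from its logarithmic form. -/
lemma exists_radialWeight_bound (hκ : 0 < κ) (hβ : 0 ≤ β) (ha : 0 ≤ a) (haγ : a ≤ γ) :
    ∃ C : ℝ, 0 < C ∧ (∀ r, 0 < r → |radialWeight n κ β a γ r| ≤ C * r ^ β) ∧
      ∀ r, 0 < r → |deriv (radialWeight n κ β a γ) r| ≤ C * r ^ (β - 1) := by
  have hγ : 0 ≤ γ := ha.trans haγ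
  set c := max 1 κ⁻¹ with hc
  have hc1 : 1 ≤ c := le_max_left _ _
  have hcκ : 1 ≤ c * κ := by
    have := mul_le_mul_of_nonneg_right (le_max_right 1 κ⁻¹) hκ.le
    rwa [inv_mul_cancel₀ hκ.ne'] at this
  have hb : ∀ r, 0 < r → radialWeight n κ β a γ r ≤ c ^ γ * κ⁻¹ * r ^ β := by
    intro r hr
    have hrn : 0 < r ^ n := pow_pos hr n
    have h1 : (1 : ℝ) ≤ 1 + r ^ n := by linarith
    have h2 : 0 < 1 + κ * r ^ n := by positivity
    have h3 : 1 + r ^ n ≤ c * (1 + κ * r ^ n) := by nlinarith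
    have h4 : (1 + r ^ n) ^ a ≤ c ^ γ * (1 + κ * r ^ n) ^ γ := by
      rw [← Real.mul_rpow (by positivity) h2.le]
      exact (Real.rpow_le_rpow_of_exponent_le h1 haγ).trans
        (Real.rpow_le_rpow (by positivity) h3 hγ)
    calc radialWeight n κ β a γ r
        ≤ r ^ β * (c ^ γ * (1 + κ * r ^ n) ^ γ) * (1 + κ * r ^ n) ^ (-γ) * κ⁻¹ := by
          unfold radialWeight
          gcongr
      _ = c ^ γ * κ⁻¹ * r ^ β := by
          rw [Real.rpow_neg h2.le]
          field_simp
  have hc0 : 0 < c ^ γ * κ⁻¹ := by positivity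
  refine ⟨c ^ γ * κ⁻¹ * (1 + β + n * a + n * γ), by positivity, fun r hr => ?_, fun r hr => ?_⟩
  · rw [abs_of_nonneg (radialWeight_nonneg hκ hr)]
    refine (hb r hr).trans ?_
    have : 0 ≤ r ^ β := by positivity
    have h5 : (1 : ℝ) ≤ 1 + β + n * a + n * γ := by
      have : 0 ≤ (n : ℝ) * a := by positivity
      have : 0 ≤ (n : ℝ) * γ := by positivity
      linarith
    exact mul_le_mul_of_nonneg_right (le_mul_of_one_le_right hc0.le h5) this
  · rw [(hasDerivAt_radialWeight hκ hr).deriv, abs_div, abs_mul, abs_of_pos hr,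
      abs_of_nonneg (radialWeight_nonneg hκ hr), Real.rpow_sub_one hr.ne',
      ← mul_div_assoc (c ^ γ * κ⁻¹ * (1 + β + n * a + n * γ))]
    have hrn : 0 < r ^ n := pow_pos hr n
    have q1 : r ^ n / (1 + r ^ n) ≤ 1 := by rw [div_le_one (by positivity)]; linarith
    have q1' : 0 ≤ r ^ n / (1 + r ^ n) := by positivity
    have q2 : κ * r ^ n / (1 + κ * r ^ n) ≤ 1 := by rw [div_le_one (by positivity)]; linarith
    have q2' : 0 ≤ κ * r ^ n / (1 + κ * r ^ n) := by positivity
    have h6 : |β + n * a * (r ^ n / (1 + r ^ n)) - n * γ * (κ * r ^ n / (1 + κ * r ^ n))| ≤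
        1 + β + n * a + n * γ := by
      have u1 : 0 ≤ (n : ℝ) * a := by positivity
      have u2 : 0 ≤ (n : ℝ) * γ := by positivity
      have v1 := mul_le_of_le_one_right u1 q1
      have v2 := mul_le_of_le_one_right u2 q2
      have v1' := mul_nonneg u1 q1'
      have v2' := mul_nonneg u2 q2'
      rw [abs_le]
      constructor <;> linarith
    refine (div_le_div_iff_of_pos_right hr).2 ?_
    calc _ ≤ (c ^ γ * κ⁻¹ * r ^ β) * (1 + β + n * a + n * γ) := by
          gcongr
          exact hb r hr
      _ = _ := by ring

end Kernel

/-! ### Pointwise bounds for the local maximal function. -/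

section MaximalFunction

variable {n : ℕ} {Ω : Set (EuclideanSpace ℝ (Fin n))} {f : EuclideanSpace ℝ (Fin n) → ℝ}
  {g : EuclideanSpace ℝ (Fin n) → EuclideanSpace ℝ (Fin n)} {β γ : ℝ}

lemma maximalFn_eq_iSup [NeZero n] (x : EuclideanSpace ℝ (Fin n)) :
    maximalFn γ β Ω f x = ⨆ (r : ℝ) (_ : 0 < r) (_ : ENNReal.ofReal r < infEDist x Ωᶜ),
      ENNReal.ofReal (|radialWeight n (volume.real (ball (0 : EuclideanSpace ℝ (Fin n)) 1))
        β (γ * β / n) γ r| * r ^ (-(n : ℝ))) * ∫⁻ y in ball x r, ‖f y‖ₑ := by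
  set κ := volume.real (ball (0 : EuclideanSpace ℝ (Fin n)) 1) with hκ
  have hκ0 : 0 < κ := by
    rw [hκ, measureReal_def, ENNReal.toReal_pos_iff]
    exact ⟨measure_ball_pos _ 0 one_pos, measure_ball_lt_top⟩
  unfold maximalFn
  refine iSup_congr fun r => iSup_congr fun hr => iSup_congr fun _ => ?_
  have hV : volume.real (ball x r) = κ * r ^ n := by
    rw [measureReal_def, Measure.addHaar_ball_of_pos _ _ hr, finrank_euclideanSpace_fin,
      ENNReal.toReal_mul, ENNReal.toReal_ofReal (by positivity), hκ, measureReal_def, mul_comm]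
  congr 1
  · rw [abs_of_nonneg (radialWeight_nonneg hκ0 hr), hV, phi, radialWeight, Real.rpow_neg hr.le,
      Real.rpow_natCast, Real.rpow_neg (by positivity)]
    congr 1
    field_simp
  · refine lintegral_congr fun y => ?_
    rw [← ofReal_norm, Real.norm_eq_abs]

lemma ball_subset_of_ofReal_le_infEDist {x : EuclideanSpace ℝ (Fin n)} {r : ℝ}
    (h : ENNReal.ofReal r ≤ infEDist x Ωᶜ) : ball x r ⊆ Ω := by
  intro z hz
  by_contra hzΩ
  have h1 := h.trans (infEDist_le_edist_of_mem (x := x) (mem_compl hzΩ))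
  rw [edist_dist, ENNReal.ofReal_le_ofReal_iff dist_nonneg, dist_comm] at h1
  exact h1.not_gt hz

lemma withDensity_indicator_ball (hΩ : IsOpen Ω) {h : EuclideanSpace ℝ (Fin n) → ℝ≥0∞}
    {x : EuclideanSpace ℝ (Fin n)} {r : ℝ} (hx : ball x r ⊆ Ω) :
    volume.withDensity (Ω.indicator h) (ball x r) = ∫⁻ y in ball x r, h y := by
  rw [withDensity_apply _ measurableSet_ball, setLIntegral_indicator hΩ.measurableSet,
    inter_eq_self_of_subset_right hx]

/-- Each constrained term is lower semicontinuous in `x`: the condition r < dist(x, Ωᶜ) is open, and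
so is exceeding a given value. No regularity of `f` enters. -/
lemma measurable_maximalFn [NeZero n] : Measurable (maximalFn γ β Ω f) := by
  have h : maximalFn γ β Ω f = fun x => ⨆ (r : ℝ) (_ : 0 < r),
      ⨆ (_ : ENNReal.ofReal r < infEDist x Ωᶜ),
        ENNReal.ofReal (|radialWeight n (volume.real (ball (0 : EuclideanSpace ℝ (Fin n)) 1))
          β (γ * β / n) γ r| * r ^ (-(n : ℝ))) *
            volume.withDensity (fun y => ‖f y‖ₑ) (ball x r) := by
    funext x
    simp only [maximalFn_eq_iSup, withDensity_apply _ measurableSet_ball]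
  rw [h]
  refine (lowerSemicontinuous_biSup fun r _ x a hxa => ?_).measurable
  simp only [gt_iff_lt, lt_iSup_iff, exists_prop] at hxa ⊢
  filter_upwards [(isOpen_lt continuous_const continuous_infEDist).mem_nhds hxa.1,
    lowerSemicontinuous_const_mul_measure_ball _ r _ x a hxa.2] with z h1 h2
  exact ⟨h1, h2⟩

/-- The maximal function is dominated by the fractional maximal function. -/
lemma maximalFn_le_mul_fractionalMaximal [NeZero n] (hΩ : IsOpen Ω) {C : ℝ} (hC : 0 < C)
    (hb : ∀ r, 0 < r → |radialWeight n (volume.real (ball (0 : EuclideanSpace ℝ (Fin n)) 1))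
      β (γ * β / n) γ r| ≤ C * r ^ β) (x : EuclideanSpace ℝ (Fin n)) :
    maximalFn γ β Ω f x ≤ ENNReal.ofReal C *
      fractionalMaximal β (volume.withDensity (Ω.indicator fun y => ‖f y‖ₑ)) x := by
  rw [maximalFn_eq_iSup]
  refine iSup_le fun r => iSup_le fun hr => iSup_le fun hrx => ?_
  rw [← withDensity_indicator_ball hΩ (ball_subset_of_ofReal_le_infEDist hrx.le)]
  set ν := volume.withDensity (Ω.indicator fun y => ‖f y‖ₑ)
  calc _ ≤ ENNReal.ofReal (C * r ^ (β - n)) * ν (ball x r) := by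
        refine mul_le_mul_left (ENNReal.ofReal_le_ofReal ?_) _
        rw [sub_eq_add_neg, Real.rpow_add hr, ← mul_assoc]
        exact mul_le_mul_of_nonneg_right (hb r hr) (by positivity)
    _ = ENNReal.ofReal C * (ENNReal.ofReal (r ^ (β - n)) * ν (ball x r)) := by
        rw [ENNReal.ofReal_mul hC.le, mul_assoc]
    _ ≤ _ := by
        gcongr
        refine le_trans (le_of_eq ?_) (le_iSup₂ (f := fun (r : ℝ) (_ : 0 < r) =>
          ENNReal.ofReal (r ^ (β - finrank ℝ (EuclideanSpace ℝ (Fin n)))) * ν (ball x r)) r hr)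
        rw [finrank_euclideanSpace_fin]

/-- The maximal function of a weakly differentiable function varies along short segments by at
most the integral of fractional maximal functions of the function and its weak gradient. -/
lemma HasWeakGradient.maximalFn_le_add_lintegral_segment [NeZero n] (hΩ : IsOpen Ω)
    (hfg : HasWeakGradient Ω f g) {C : ℝ}
    (hb : ∀ r, 0 < r → |radialWeight n (volume.real (ball (0 : EuclideanSpace ℝ (Fin n)) 1))
      β (γ * β / n) γ r| ≤ C * r ^ β)
    (hb' : ∀ r, 0 < r → |deriv (radialWeight n
      (volume.real (ball (0 : EuclideanSpace ℝ (Fin n)) 1)) β (γ * β / n) γ) r| ≤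
        C * r ^ (β - 1))
    {x y : EuclideanSpace ℝ (Fin n)} (hxy : ENNReal.ofReal (dist x y) < infEDist x Ωᶜ) :
    maximalFn γ β Ω f x ≤ maximalFn γ β Ω f y + ENNReal.ofReal (dist x y) *
      ∫⁻ t in Icc (0 : ℝ) 1, (fun z => ENNReal.ofReal C *
        (fractionalMaximal (β - 1) (volume.withDensity (Ω.indicator fun y => ‖f y‖ₑ)) z +
          2 * fractionalMaximal β (volume.withDensity (Ω.indicator fun y => ‖g y‖ₑ)) z))
        (x + t • (y - x)) := by
  have hκ0 : 0 < volume.real (ball (0 : EuclideanSpace ℝ (Fin n)) 1) := by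
    rw [measureReal_def, ENNReal.toReal_pos_iff]
    exact ⟨measure_ball_pos _ 0 one_pos, measure_ball_lt_top⟩
  set δ := dist x y with hδ
  have hδ0 : 0 ≤ δ := dist_nonneg
  rw [maximalFn_eq_iSup x]
  refine iSup_le fun r => iSup_le fun hr => iSup_le fun hrx => ?_
  have hmax : ENNReal.ofReal (max r δ) < infEDist x Ωᶜ := by
    rcases max_choice r δ with h | h <;> rw [h] <;> assumption
  obtain ⟨D, hD1, hD2⟩ := ENNReal.lt_iff_exists_nnreal_btwn.1 hmax
  rw [← ENNReal.ofReal_coe_nnreal] at hD1 hD2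
  have hD3 : max r δ < D := (ENNReal.ofReal_lt_ofReal_iff_of_nonneg (by positivity)).1 hD1
  have hrD : r < D := (le_max_left _ _).trans_lt hD3
  have hδD : δ < D := (le_max_right _ _).trans_lt hD3
  have hD0 : (0 : ℝ) < D := hr.trans hrD
  have hDΩ : closedBall x D ⊆ Ω := by
    intro z hz
    by_contra hzΩ
    have h1 := hD2.trans_le (infEDist_le_edist_of_mem (x := x) (mem_compl hzΩ))
    rw [edist_dist, ENNReal.ofReal_lt_ofReal_iff_of_nonneg hD0.le, dist_comm] at h1
    exact h1.not_ge hz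
  set m := r * δ / D with hm
  have hm0 : 0 ≤ m := by positivity
  have hmr : m < r := by
    rw [hm, div_lt_iff₀ hD0]; nlinarith
  have key := hfg.setLIntegral_ball_le hΩ (contDiffOn_radialWeight hκ0) hb hb' hr hrD hδD hDΩ hm
  refine key.trans (add_le_add ?_ ?_)
  · rw [maximalFn_eq_iSup y]
    refine le_iSup_of_le (r - m) (le_iSup_of_le (by linarith) (le_iSup_of_le ?_ le_rfl))
    -- The end ball is admissible for `y`: otherwise dist(x, Ωᶜ) ≤ (r-m) + δ ≤ D, against the choice
    -- of `D`.
    by_contra hcon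
    have h1 : infEDist x Ωᶜ ≤ ENNReal.ofReal (r - m) + ENNReal.ofReal δ := by
      rw [hδ, ← edist_dist]
      exact infEDist_le_infEDist_add_edist.trans (by gcongr; exact not_lt.1 hcon)
    rw [← ENNReal.ofReal_add (by linarith) hδ0] at h1
    have h2 := (ENNReal.ofReal_lt_ofReal_iff_of_nonneg hD0.le).1 (hD2.trans_le h1)
    have h3 := segment_radius_le hr hrD hδ0 hδD hm (t := 1) ⟨zero_le_one, le_rfl⟩
    linarith
  · rw [mul_comm C, ENNReal.ofReal_mul hδ0, mul_assoc, ← lintegral_const_mul' _ _ ENNReal.ofReal_ne_top]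
    refine mul_le_mul_right ?_ _
    refine setLIntegral_mono' measurableSet_Icc fun t ht => ?_
    have hρ : 0 < r - t * m := by nlinarith [ht.1, ht.2]
    have hsub : ball (x + t • (y - x)) (r - t * m) ⊆ Ω :=
      (ball_segment_subset hr hrD hδD hm ht).trans (ball_subset_closedBall.trans hDΩ)
    rw [← withDensity_indicator_ball hΩ hsub, ← withDensity_indicator_ball hΩ hsub]
    have hle : ∀ (α : ℝ) (ν : Measure (EuclideanSpace ℝ (Fin n))),
        ENNReal.ofReal ((r - t * m) ^ (α - n)) * ν (ball (x + t • (y - x)) (r - t * m)) ≤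
          fractionalMaximal α ν (x + t • (y - x)) := by
      intro α ν
      refine le_trans (le_of_eq ?_) (le_iSup₂ (f := fun (r : ℝ) (_ : 0 < r) =>
        ENNReal.ofReal (r ^ (α - finrank ℝ (EuclideanSpace ℝ (Fin n)))) *
          ν (ball (x + t • (y - x)) r)) (r - t * m) hρ)
      rw [finrank_euclideanSpace_fin]
    exact mul_le_mul_right (add_le_add (hle _ _) (mul_le_mul_right (hle _ _) _)) _

end MaximalFunction

/-! ### Norm estimates and conclusion. -/

section Assembly

variable {n : ℕ} {Ω : Set (EuclideanSpace ℝ (Fin n))}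

lemma HasWeakGradient.ae_eq_weakGradient (hΩ : IsOpen Ω) {f : EuclideanSpace ℝ (Fin n) → ℝ}
    {g : EuclideanSpace ℝ (Fin n) → EuclideanSpace ℝ (Fin n)} (hfg : HasWeakGradient Ω f g) :
    weakGradient Ω f =ᵐ[volume.restrict Ω] g := by
  have hex : ∃ g, HasWeakGradient Ω f g := ⟨g, hfg⟩
  rw [weakGradient, dif_pos hex]
  exact hex.choose_spec.ae_eq hΩ hfg

lemma MemSobolev.sobolevNorm_lt_top (hΩ : IsOpen Ω) {p : ℝ} {f : EuclideanSpace ℝ (Fin n) → ℝ}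
    (hf : MemSobolev Ω p f) : sobolevNorm Ω p f < ⊤ := by
  obtain ⟨h1, g, hfg, hg⟩ := hf
  rw [sobolevNorm, eLpNorm_congr_ae (hfg.ae_eq_weakGradient hΩ)]
  exact ENNReal.add_lt_top.2 ⟨h1.2, hg.2⟩

/-- The fractional maximal inequality on an open subset of Euclidean space. -/
lemma eLpNorm_fractionalMaximal_indicator_le [NeZero n] {s α q : ℝ} (hs : 1 < s) (hα : 0 ≤ α)
    (hαs : α < n / s) (hq : 1 / q = 1 / s - α / n) :
    ∃ C : NNReal, ∀ (Ω : Set (EuclideanSpace ℝ (Fin n))), MeasurableSet Ω →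
      ∀ {G : Type} [NormedAddCommGroup G] (u : EuclideanSpace ℝ (Fin n) → G),
      MemLp u (.ofReal s) (volume.restrict Ω) →
      eLpNorm (fractionalMaximal α (volume.withDensity (Ω.indicator fun y => ‖u y‖ₑ)))
        (.ofReal q) volume ≤ C * eLpNorm u (.ofReal s) (volume.restrict Ω) := by
  obtain ⟨C, hC, H⟩ := eLpNorm_fractionalMaximal_le
    (volume : Measure (EuclideanSpace ℝ (Fin n))) (s := s) (α := α) (q := q) hs hα
    (by rwa [finrank_euclideanSpace_fin]) (by rwa [finrank_euclideanSpace_fin])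
  refine ⟨C.toNNReal, fun Ω hΩ G _ u hu => ?_⟩
  have e1 : eLpNorm (Ω.indicator fun y => ‖u y‖ₑ) (.ofReal s) volume =
      eLpNorm u (.ofReal s) (volume.restrict Ω) := by
    rw [eLpNorm_indicator_eq_eLpNorm_restrict hΩ, eLpNorm_enorm]
  have := H (Ω.indicator fun y => ‖u y‖ₑ) ((aemeasurable_indicator_iff hΩ).2 hu.1.enorm)
    (by rw [e1]; exact hu.2.ne)
  rwa [e1, ← ENNReal.coe_toNNReal hC] at this

/-- The local fractional maximal function is bounded from `W^{1,p}(Ω)` to `W^{1,q}(Ω)`. -/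
theorem exists_sobolevNorm_maximalFn_le
    (hΩ_open : IsOpen Ω) {p q β γ : ℝ} (hp : 1 < p) (hpn : p < n) (hβ : 1 ≤ β) (hβn : β < n / p)
    (hγ : 0 ≤ γ) (hq : 1 / q = 1 / p - β / n)
    (hemb : AdmitsSobolevEmbedding Ω p) :
    ∃ C : ℝ, 0 < C ∧ ∀ f : EuclideanSpace ℝ (Fin n) → ℝ, MemSobolev Ω p f →
      (∀ᵐ x ∂(volume.restrict Ω), maximalFn γ β Ω f x < ⊤) ∧
      MemSobolev Ω q (fun x => (maximalFn γ β Ω f x).toReal) ∧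
      sobolevNorm Ω q (fun x => (maximalFn γ β Ω f x).toReal)
        ≤ ENNReal.ofReal C * sobolevNorm Ω p f := by
  have hn0 : (0 : ℝ) < n := by linarith
  have : NeZero n := ⟨by rintro rfl; simp at hn0⟩
  have hp0 : 0 < p := by linarith
  have hβpn : β * p < n := by rwa [lt_div_iff₀ hp0] at hβn
  -- This gives γβ/n ≤ γ, the condition needed for the kernel bounds.
  have hβn' : β ≤ n := by nlinarith
  have hq0 : 0 < q := by
    rw [← one_div_pos, hq, sub_pos, div_lt_div_iff₀ hn0 hp0]
    linarith
  have hq1 : 1 ≤ q := by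
    have h1 : 1 / q ≤ 1 := by
      rw [hq]
      have h2 : 1 / p ≤ 1 := by rw [div_le_one hp0]; exact hp.le
      have h3 : 0 ≤ β / n := by positivity
      linarith
    rwa [div_le_one hq0] at h1
  have hq1' : (1 : ℝ≥0∞) ≤ .ofReal q := by simpa using hq1
  set s := n * p / (n - p) with hs
  have hnp : 0 < (n : ℝ) - p := by linarith
  have hs1 : 1 < s := by
    rw [hs, lt_div_iff₀ hnp]; nlinarith
  have hns : (n : ℝ) / s = n / p - 1 := by rw [hs]; field_simp
  -- With s = p*, the operator of order β-1 on L^s has the same target L^q as the operator of order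
  -- β on L^p.
  have hqs : 1 / q = 1 / s - (β - 1) / n := by
    rw [hq, hs]; field_simp; ring
  have hκ0 : 0 < volume.real (ball (0 : EuclideanSpace ℝ (Fin n)) 1) := by
    rw [measureReal_def, ENNReal.toReal_pos_iff]
    exact ⟨measure_ball_pos _ 0 one_pos, measure_ball_lt_top⟩
  obtain ⟨C, hC, hb, hb'⟩ := exists_radialWeight_bound (n := n) (a := γ * β / n) (β := β) (γ := γ)
    hκ0 (by linarith) (by positivity) (by rw [div_le_iff₀ hn0]; gcongr)
  obtain ⟨C₁, hC₁⟩ := eLpNorm_fractionalMaximal_indicator_le (n := n) hp (by linarith) hβn hq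
  obtain ⟨C₂, hC₂⟩ := eLpNorm_fractionalMaximal_indicator_le (n := n) hs1
    (by linarith : 0 ≤ β - 1) (by rw [hns]; linarith) hqs
  obtain ⟨C₀, hC₀, hS⟩ := hemb
  obtain ⟨Cn, hCn⟩ : ∃ Cn : NNReal, ENNReal.ofReal C = Cn := ⟨_, rfl⟩
  obtain ⟨C₀n, hC₀n⟩ : ∃ Cn : NNReal, ENNReal.ofReal C₀ = Cn := ⟨_, rfl⟩
  -- The first summand bounds the function, the second its gradient; the 1 only ensures positivity.
  set A : NNReal := Cn * C₁ + 2 * n * (Cn * (C₂ * C₀n + 2 * C₁)) + 1 with hA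
  refine ⟨A, by positivity, fun f hf => ?_⟩
  have hNtop := hf.sobolevNorm_lt_top hΩ_open
  set N := sobolevNorm Ω p f with hN
  obtain ⟨hfp, g, hfg, hgp⟩ := hf
  have hfN : eLpNorm f (.ofReal p) (volume.restrict Ω) ≤ N := le_self_add
  have hgN : eLpNorm g (.ofReal p) (volume.restrict Ω) ≤ N := by
    rw [← eLpNorm_congr_ae (hfg.ae_eq_weakGradient hΩ_open)]
    exact le_add_self
  -- The only use of the Sobolev embedding: it makes M_(β-1)|f| an L^q function.
  have hfs : eLpNorm f (.ofReal s) (volume.restrict Ω) ≤ C₀n * N := by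
    rw [← hC₀n]; exact hS f ⟨hfp, g, hfg, hgp⟩
  have hfsm : MemLp f (.ofReal s) (volume.restrict Ω) :=
    ⟨hfp.1, hfs.trans_lt (by finiteness)⟩
  set F := maximalFn γ β Ω f with hF
  set Mf := fractionalMaximal β (volume.withDensity (Ω.indicator fun y => ‖f y‖ₑ)) with hMf
  set Mg := fractionalMaximal β (volume.withDensity (Ω.indicator fun y => ‖g y‖ₑ)) with hMg
  set M' := fractionalMaximal (β - 1) (volume.withDensity (Ω.indicator fun y => ‖f y‖ₑ)) with hM'
  have n1 : eLpNorm Mf (.ofReal q) volume ≤ C₁ * N :=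
    (hC₁ Ω hΩ_open.measurableSet f hfp).trans (by gcongr)
  have n2 : eLpNorm Mg (.ofReal q) volume ≤ C₁ * N :=
    (hC₁ Ω hΩ_open.measurableSet g hgp).trans (by gcongr)
  have n3 : eLpNorm M' (.ofReal q) volume ≤ C₂ * (C₀n * N) :=
    (hC₂ Ω hΩ_open.measurableSet f hfsm).trans (by gcongr)
  have hMgm : Measurable Mg := measurable_fractionalMaximal _ _
  have hM'm : Measurable M' := measurable_fractionalMaximal _ _
  have hFMf : ∀ x, F x ≤ Cn * Mf x := fun x => by
    rw [← hCn]; exact maximalFn_le_mul_fractionalMaximal hΩ_open hC hb x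
  have nF : eLpNorm F (.ofReal q) volume ≤ Cn * (C₁ * N) :=
    (eLpNorm_le_nnreal_smul_eLpNorm_of_ae_le_mul' (c := Cn) (g := Mf)
      (Eventually.of_forall fun x => by simpa using hFMf x) _).trans
      (by rw [ENNReal.smul_def, smul_eq_mul]; gcongr)
  have hFm : Measurable F := measurable_maximalFn
  have lt_top_of : ∀ u : EuclideanSpace ℝ (Fin n) → ℝ≥0∞, Measurable u →
      eLpNorm u (.ofReal q) volume < ⊤ → ∀ᵐ x, u x < ⊤ := by
    intro u hu hlt
    have h1 := lintegral_rpow_enorm_lt_top_of_eLpNorm_lt_top (by simpa using hq0)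
      ENNReal.ofReal_ne_top hlt
    rw [ENNReal.toReal_ofReal hq0.le] at h1
    filter_upwards [ae_lt_top (by fun_prop) h1.ne] with x hx
    simpa [ENNReal.rpow_lt_top_iff_of_pos hq0] using hx
  have hFtop : ∀ᵐ x, F x < ⊤ := lt_top_of F hFm (nF.trans_lt (by finiteness))
  have hFr : eLpNorm (fun x => (F x).toReal) (.ofReal q) (volume.restrict Ω) ≤ Cn * (C₁ * N) := by
    refine le_trans (eLpNorm_mono_enorm fun x => ?_) ((eLpNorm_restrict_le F _ _ _).trans nF)
    rw [Real.enorm_of_nonneg ENNReal.toReal_nonneg]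
    exact ENNReal.ofReal_toReal_le
  have hFmem : MemLp (fun x => (F x).toReal) (.ofReal q) (volume.restrict Ω) :=
    ⟨hFm.ennreal_toReal.aestronglyMeasurable, hFr.trans_lt (by finiteness)⟩
  set G : EuclideanSpace ℝ (Fin n) → ℝ≥0∞ := fun z => ENNReal.ofReal C * (M' z + 2 * Mg z) with hG
  have hGm : Measurable G := by fun_prop
  have nG : eLpNorm G (.ofReal q) volume ≤ Cn * (C₂ * (C₀n * N) + 2 * (C₁ * N)) := by
    have h1 : eLpNorm G (.ofReal q) volume ≤
        Cn • eLpNorm (M' + fun z => 2 * Mg z) (.ofReal q) volume :=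
      eLpNorm_le_nnreal_smul_eLpNorm_of_ae_le_mul' (c := Cn)
        (Eventually.of_forall fun x => by simp [hG, hCn]) _
    have h2 : eLpNorm (fun z => 2 * Mg z) (.ofReal q) volume ≤
        (2 : NNReal) • eLpNorm Mg (.ofReal q) volume :=
      eLpNorm_le_nnreal_smul_eLpNorm_of_ae_le_mul' (c := 2)
        (Eventually.of_forall fun x => by simp) _
    have h3 := eLpNorm_add_le (μ := volume) hM'm.aestronglyMeasurable
      (hMgm.const_mul 2).aestronglyMeasurable hq1'
    rw [ENNReal.smul_def, smul_eq_mul] at h1 h2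
    refine h1.trans (mul_le_mul_right (h3.trans (add_le_add n3 (h2.trans ?_))) _)
    exact mul_le_mul_right n2 _
  have hGlt : eLpNorm G (.ofReal q) volume < ⊤ := nG.trans_lt (by finiteness)
  have hGmem : MemLp G (.ofReal q) volume := ⟨hGm.aestronglyMeasurable, hGlt⟩
  obtain ⟨w, hwm, hFw, hwG⟩ := exists_hasWeakGradient_of_segment_bound hΩ_open (F := F) hGm
    (fun K _ hK => by
      have := ((hGmem.locallyIntegrable hq1').integrableOn_isCompact hK).2
      simpa [hasFiniteIntegral_def] using this.ne)
    ((lt_top_of G hGm hGlt).mono fun x hx => hx.ne)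
    (hFtop.mono fun x hx _ => hx.ne)
    (locallyIntegrableOn_of_locallyIntegrable_restrict (hFmem.locallyIntegrable hq1'))
    (fun x y hxy => hfg.maximalFn_le_add_lintegral_segment hΩ_open hb hb' hxy)
  have hw : eLpNorm w (.ofReal q) (volume.restrict Ω) ≤
      2 * n * (Cn * (C₂ * (C₀n * N) + 2 * (C₁ * N))) := by
    refine (eLpNorm_restrict_le w _ _ _).trans ?_
    refine (eLpNorm_le_nnreal_smul_eLpNorm_of_ae_le_mul' (c := 2 * n) (g := G) ?_ _).trans ?_
    · filter_upwards [hwG] with x hx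
      simpa using hx
    · rw [ENNReal.smul_def, smul_eq_mul]
      push_cast
      gcongr
  refine ⟨ae_restrict_of_ae hFtop, ⟨hFmem, w, hFw, hwm.aestronglyMeasurable,
    hw.trans_lt (by finiteness)⟩, ?_⟩
  rw [sobolevNorm, eLpNorm_congr_ae (hFw.ae_eq_weakGradient hΩ_open), ENNReal.ofReal_coe_nnreal]
  refine (add_le_add hFr hw).trans ?_
  rw [hA]
  push_cast
  calc _ = (Cn * C₁ + 2 * n * (Cn * (C₂ * C₀n + 2 * C₁)) : ℝ≥0∞) * N := by ring
    _ ≤ _ := mul_le_mul_left le_self_add _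

end Assembly

end LocalMaximal

theorem theorem1p3 (n : ℕ) (Ω : Set (EuclideanSpace ℝ (Fin n)))
    (hΩ_open : IsOpen Ω) (hΩ_conn : IsConnected Ω)
    (p q β γ : ℝ) (hp : 1 < p) (hpn : p < n) (hβ : 1 ≤ β) (hβn : β < n / p)
    (hγ : 0 ≤ γ) (hγn : γ ≤ n) (hq : 1 / q = 1 / p - β / n)
    (hemb : LocalMaximal.AdmitsSobolevEmbedding Ω p) :
    ∃ C : ℝ, 0 < C ∧ ∀ f : EuclideanSpace ℝ (Fin n) → ℝ, LocalMaximal.MemSobolev Ω p f →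
      (∀ᵐ x ∂(volume.restrict Ω), LocalMaximal.maximalFn γ β Ω f x < ⊤) ∧
      LocalMaximal.MemSobolev Ω q (fun x => (LocalMaximal.maximalFn γ β Ω f x).toReal) ∧
      LocalMaximal.sobolevNorm Ω q (fun x => (LocalMaximal.maximalFn γ β Ω f x).toReal)
        ≤ ENNReal.ofReal C * LocalMaximal.sobolevNorm Ω p f :=
  LocalMaximal.exists_sobolevNorm_maximalFn_le hΩ_open hp hpn hβ hβn hγ hq hemb
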